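/- Let $p\ge 1$, $0<\alpha_1<1$, $\alpha_2:=1-\alpha_1$, let $\mu_1\neq\mu_2$ be vectors in $\mathbb{R}^p$ and let $\Sigma\in\mathbb{R}^{p\times p}$ be symmetric positive definite. Let the pair $(x,y)$ satisfy $y\sim\mathrm{Ber}(\alpha_1)$ and $x\mid y\sim\mathcal{N}_p\{y\mu_1+(1-y)\mu_2,\Sigma\}$, and let $x_1,x_2,\ldots$ be i.i.d. random vectors on a probability space whose common distribution is the marginal distribution of $x$. Put $$\theta:=\Sigma^{-1}(\mu_2-\mu_1),\qquad \beta:=\alpha_1\alpha_2,\qquad \tau:=(\mu_2-\mu_1)'\Sigma^{-1}(\mu_2-\mu_1),$$ and for $u$ in the unit sphere $\mathbb{S}^{p-1}$ define the sample skewness $$\gamma_n(u):=\frac{(1/n)\sum_{i=1}^n\{u'(x_i-\bar x_n)\}^3}{\left[(1/n)\sum_{i=1}^n\{u'(x_i-\bar x_n)\}^2\right]^{3/2}},\qquad \bar x_n:=\frac1n\sum_{i=1}^n x_i .$$ Assume that $\alpha_1\neq 1/2$, and let $u_n$ be any sequence of ($\mathbb{S}^{p-1}$-valued, random) maximizers of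 $u\mapsto\gamma_n(u)^2$ over $\mathbb{S}^{p-1}$; it suffices that $u_n$ is a random vector for every $n$ and that, almost surely, $u_n$ is a maximizer for all sufficiently large $n$. Then there is a sequence of random signs $s_n\in\{-1,1\}$ such that, as $n\to\infty$, 1. $s_nu_n\to\theta/\|\theta\|$ almost surely; 2. $\sqrt n\,(s_nu_n-\theta/\|\theta\|)\rightsquigarrow\mathcal{N}_p(0,\Psi_\gamma)$ in distribution, where $\Psi_\gamma:=C_\gamma\Psi_U$ (a positive semidefinite matrix) with $$\Psi_U:=\left(\frac{1+\beta\tau}{\|\theta\|^2\beta}\right)\left(I_p-\frac{\theta\theta'}{\|\theta\|^2}\right)\Sigma^{-1}\left(I_p-\frac{\theta\theta'}{\|\theta\|^2}\right),\qquad C_\gamma:=\frac{2+6\beta\tau+\beta\tau^2}{\beta\tau^2(1-4\beta)} .$$ -/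

import Mathlib

open MeasureTheory ProbabilityTheory Filter Topology
open scoped Matrix

noncomputable section

namespace SkewnessPP

/-- Vectors of `ℝ^p` with the Euclidean norm. -/
abbrev Vec (p : ℕ) : Type := EuclideanSpace ℝ (Fin p)

/-- The joint law of the pair `(y, x)`: `y ∼ Ber(α₁)` takes the values `0` and `1`
(with `ℙ(y = 1) = α₁`), and `x ∣ y ∼ N_p(y μ₁ + (1 - y) μ₂, S)`. -/
def pairLaw {p : ℕ} (α₁ : unitInterval) (μ₁ μ₂ : Vec p) (S : Matrix (Fin p) (Fin p) ℝ) :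
    Measure (ℕ × Vec p) :=
  (bernoulliMeasure (1 : ℕ) 0 α₁) ⊗ₘ
    (Kernel.ofFunOfCountable
      (fun y : ℕ => multivariateGaussian ((y : ℝ) • μ₁ + (1 - (y : ℝ)) • μ₂) S))

/-- The marginal law of `x` under `pairLaw`. -/
def xLaw {p : ℕ} (α₁ : unitInterval) (μ₁ μ₂ : Vec p) (S : Matrix (Fin p) (Fin p) ℝ) :
    Measure (Vec p) :=
  (pairLaw α₁ μ₁ μ₂ S).snd

/-- The linear discriminant direction `θ = S⁻¹ (μ₂ - μ₁)`. -/
def discriminant {p : ℕ} (μ₁ μ₂ : Vec p) (S : Matrix (Fin p) (Fin p) ℝ) : Vec p :=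
  WithLp.toLp 2 (S⁻¹ *ᵥ (μ₂ - μ₁).ofLp)

/-- The standardized direction `θ / ‖θ‖`. -/
def unitDiscriminant {p : ℕ} (μ₁ μ₂ : Vec p) (S : Matrix (Fin p) (Fin p) ℝ) : Vec p :=
  ‖discriminant μ₁ μ₂ S‖⁻¹ • discriminant μ₁ μ₂ S

/-- The squared Mahalanobis distance `τ = (μ₂ - μ₁)' S⁻¹ (μ₂ - μ₁)`. -/
def mahalanobisSq {p : ℕ} (μ₁ μ₂ : Vec p) (S : Matrix (Fin p) (Fin p) ℝ) : ℝ :=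
  (μ₂ - μ₁).ofLp ⬝ᵥ (S⁻¹ *ᵥ (μ₂ - μ₁).ofLp)

/-- `β = α₁ α₂` with `α₂ = 1 - α₁`. -/
def mixBeta (α₁ : ℝ) : ℝ := α₁ * (1 - α₁)

/-- The projection matrix `I - θ θ' / ‖θ‖²`. -/
def orthProj {p : ℕ} (θ : Vec p) : Matrix (Fin p) (Fin p) ℝ :=
  1 - (‖θ‖ ^ 2)⁻¹ • Matrix.vecMulVec θ.ofLp θ.ofLp

/-- `Ψ_U = ((1 + β τ) / (‖θ‖² β)) (I - θ θ' / ‖θ‖²) S⁻¹ (I - θ θ' / ‖θ‖²)`. -/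
def PsiU {p : ℕ} (α₁ : ℝ) (μ₁ μ₂ : Vec p) (S : Matrix (Fin p) (Fin p) ℝ) :
    Matrix (Fin p) (Fin p) ℝ :=
  ((1 + mixBeta α₁ * mahalanobisSq μ₁ μ₂ S) /
      (‖discriminant μ₁ μ₂ S‖ ^ 2 * mixBeta α₁)) •
    (orthProj (discriminant μ₁ μ₂ S) * S⁻¹ * orthProj (discriminant μ₁ μ₂ S))

/-- `C_γ = (2 + 6 β τ + β τ²) / (β τ² (1 - 4 β))`. -/
def Cgamma (β τ : ℝ) : ℝ :=
  (2 + 6 * β * τ + β * τ ^ 2) / (β * τ ^ 2 * (1 - 4 * β))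

/-- `Ψ_γ = C_γ Ψ_U`. -/
def PsiGamma {p : ℕ} (α₁ : ℝ) (μ₁ μ₂ : Vec p) (S : Matrix (Fin p) (Fin p) ℝ) :
    Matrix (Fin p) (Fin p) ℝ :=
  Cgamma (mixBeta α₁) (mahalanobisSq μ₁ μ₂ S) • PsiU α₁ μ₁ μ₂ S

/-- The sample mean of `x 0, …, x (n - 1)`. -/
def sampleMean {p : ℕ} (x : ℕ → Vec p) (n : ℕ) : Vec p :=
  (n : ℝ)⁻¹ • ∑ i ∈ Finset.range n, x i

/-- The `k`-th central sample moment `(1/n) ∑ᵢ (u'(xᵢ - x̄))^k` of the projections of the first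
`n` observations on `u`. -/
def sampleMoment {p : ℕ} (x : ℕ → Vec p) (n k : ℕ) (u : Vec p) : ℝ :=
  (n : ℝ)⁻¹ * ∑ i ∈ Finset.range n, (inner ℝ u (x i - sampleMean x n)) ^ k

/-- The sample skewness `γ_n(u)` of the projections of the first `n` observations on `u`. -/
def sampleSkewness {p : ℕ} (x : ℕ → Vec p) (n : ℕ) (u : Vec p) : ℝ :=
  sampleMoment x n 3 u / (sampleMoment x n 2 u) ^ (3 / 2 : ℝ)

/-- `u` maximizes `γ_n²` over the unit sphere. -/
def IsSkewnessMaximizer {p : ℕ} (x : ℕ → Vec p) (n : ℕ) (u : Vec p) : Prop :=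
  u ∈ Metric.sphere (0 : Vec p) 1 ∧
    IsMaxOn (fun v => (sampleSkewness x n v) ^ 2) (Metric.sphere (0 : Vec p) 1) u

end SkewnessPP

end

namespace SkewnessPP
-- Write `h = μ₂ - μ₁`, `R = S⁻¹`, and let `u` be the unit vector along `R h`. The squared skewness
-- is `T₃(v,v,v)² / T₂(v,v)³`, invariant under scaling `v`. In the population `T₂ = S + β h h'` and
-- `T₃ = c h ⊗ h ⊗ h` with `c = β (2 α₁ - 1) ≠ 0`, so it is an increasing function of `(h'v)² /
-- (v'Sv)`. By Cauchy-Schwarz its only maximizers are `±u` (`PopModel.eq_unitDir`). The strong law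
-- for the moment operators (`ae_momentsConverge`) and compactness of the sphere then give
-- consistency once signs are fixed (`tendsto_of_maximizers`).
--
-- For the limit law no second-order expansion of the objective is needed. A maximizer satisfies the
-- vector equation `B T₃(v,v) = C T₂ v`, with `B`, `C` its sample second and third moments
-- (`IsSkewnessMaximizer.first_order`). Subtracting the same expression at `u` is exact and leaves
-- an operator applied to `v - u`. Let `Γ` be `R` followed by the projection off `u`. As `Γ h = 0`,
-- every rank one term vanishes in the limit and the operator tends to a multiple of the projection.
-- Hence `v - u` is almost surely equivalent to an explicit score (`isEquivalent_score`).
--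
-- By Slutsky the score behaves like the average of `g(u'(x - m)) Γ(x - m)`, with `m` the mixture
-- mean and `g` quadratic. Since `Γ h = 0` and `Γ x` is uncorrelated with `u'x` in each Gaussian
-- component, the two factors are independent under the mixture. The limiting covariance is
-- therefore `E g²` times that of `Γ x` (`tendstoInDistribution_quad`), and `integral_quad_xLaw`
-- evaluates `E g²`.
noncomputable def avg {E : Type*} [AddCommGroup E] [Module ℝ E] (n : ℕ) (f : ℕ → E) : E :=
  (n : ℝ)⁻¹ • ∑ i ∈ Finset.range n, f i

/-! ### Averages and their centering identities. -/

section avg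

variable {E F : Type*} [AddCommGroup E] [Module ℝ E] [AddCommGroup F] [Module ℝ F]

lemma sum_eq_smul_avg {n : ℕ} (hn : n ≠ 0) (f : ℕ → E) :
    ∑ i ∈ Finset.range n, f i = (n : ℝ) • avg n f := by
  rw [avg, smul_smul, mul_inv_cancel₀ (by exact_mod_cast hn), one_smul]

lemma map_avg (L : E →ₗ[ℝ] F) (n : ℕ) (f : ℕ → E) : L (avg n f) = avg n (fun i => L (f i)) := by
  simp [avg]

/-- The case `n = 0` must be excluded: there `avg` is `0` because `0⁻¹ = 0`, and the right side
would be `-m`. -/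
lemma avg_sub_const {n : ℕ} (hn : n ≠ 0) (f : ℕ → E) (m : E) :
    avg n (fun i => f i - m) = avg n f - m := by
  have h : (n : ℝ) ≠ 0 := by exact_mod_cast hn
  simp [avg, smul_sub, ← Nat.cast_smul_eq_nsmul ℝ, smul_smul, h]

lemma avg_centered_smul {n : ℕ} (hn : n ≠ 0) (a : ℕ → ℝ) (z : ℕ → E) :
    avg n (fun i => (a i - avg n a) • (z i - avg n z)) =
      avg n (fun i => a i • z i) - avg n a • avg n z := by
  have h : (n : ℝ) ≠ 0 := by exact_mod_cast hn
  -- The averages become atoms so that the summands expand as polynomials in them; the sums are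
  -- folded back afterwards.
  generalize hα : avg n a = α
  generalize hζ : avg n z = ζ
  have e : ∀ i, (a i - α) • (z i - ζ) = a i • z i - α • z i - (a i - α) • ζ := by
    intro i; module
  rw [avg]
  simp only [e, Finset.sum_sub_distrib, ← Finset.smul_sum, ← Finset.sum_smul,
    Finset.sum_const, Finset.card_range]
  rw [sum_eq_smul_avg hn z, sum_eq_smul_avg hn a, sum_eq_smul_avg hn (fun i => a i • z i), hα, hζ]
  simp only [smul_eq_mul, nsmul_eq_mul]
  match_scalars <;> field_simp
  ring

lemma avg_centered_mul_smul {n : ℕ} (hn : n ≠ 0) (a b : ℕ → ℝ) (z : ℕ → E) :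
    avg n (fun i => ((a i - avg n a) * (b i - avg n b)) • (z i - avg n z)) =
      avg n (fun i => (a i * b i) • z i) - avg n a • avg n (fun i => b i • z i)
        - avg n b • avg n (fun i => a i • z i) - avg n (fun i => a i * b i) • avg n z
        + (2 * avg n a * avg n b) • avg n z := by
  have h : (n : ℝ) ≠ 0 := by exact_mod_cast hn
  generalize hα : avg n a = α
  generalize hβ : avg n b = β
  generalize hζ : avg n z = ζ
  have e : ∀ i, ((a i - α) * (b i - β)) • (z i - ζ) =
      (a i * b i) • z i - α • b i • z i - β • a i • z i + (α * β) • z i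
        - (a i * b i - β * a i - α * b i + α * β) • ζ := by
    intro i; module
  rw [avg]
  simp only [e, Finset.sum_sub_distrib, Finset.sum_add_distrib, ← Finset.smul_sum,
    ← Finset.sum_smul, Finset.sum_const, Finset.card_range, ← Finset.mul_sum]
  rw [sum_eq_smul_avg hn z, sum_eq_smul_avg hn a, sum_eq_smul_avg hn b,
    sum_eq_smul_avg hn (fun i => a i • z i), sum_eq_smul_avg hn (fun i => b i • z i),
    sum_eq_smul_avg hn (fun i => (a i * b i) • z i), sum_eq_smul_avg hn (fun i => a i * b i),
    hα, hβ, hζ]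
  simp only [smul_eq_mul, nsmul_eq_mul]
  match_scalars <;> field_simp
  ring

end avg

/-! ### Outer products -/

/-- The rank one operator `z ↦ ⟪y, z⟫ x`, bilinear in `(x, y)`. -/
noncomputable def outer (p : ℕ) : Vec p →L[ℝ] Vec p →L[ℝ] Vec p →L[ℝ] Vec p :=
  ((ContinuousLinearMap.smulRightL ℝ (Vec p) (Vec p)).comp (innerSL ℝ)).flip

@[simp] lemma outer_apply {p : ℕ} (x y z : Vec p) : outer p x y z = inner ℝ y z • x := rfl

/-- The trilinear operator `(y, z) ↦ ⟪x, y⟫ ⟪x, z⟫ x`. -/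
noncomputable def outerCube {p : ℕ} (x : Vec p) : Vec p →L[ℝ] Vec p →L[ℝ] Vec p :=
  ContinuousLinearMap.smulRightL ℝ (Vec p) (Vec p →L[ℝ] Vec p) (innerSL ℝ x) (outer p x x)

@[simp] lemma outerCube_apply {p : ℕ} (x y z : Vec p) :
    outerCube x y z = inner ℝ x y • inner ℝ x z • x := rfl

lemma continuous_outerCube {p : ℕ} : Continuous (outerCube (p := p)) := by
  unfold outerCube; fun_prop

/-- The sample covariance operator. -/
noncomputable def sampleCov {p : ℕ} (x : ℕ → Vec p) (n : ℕ) : Vec p →L[ℝ] Vec p :=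
  avg n (fun i => outer p (x i - sampleMean x n) (x i - sampleMean x n))

/-- The contraction of the sample third central moment tensor with `y`, as an operator. -/
noncomputable def sampleThird {p : ℕ} (x : ℕ → Vec p) (n : ℕ) (y : Vec p) : Vec p →L[ℝ] Vec p :=
  avg n (fun i => inner ℝ (x i - sampleMean x n) y •
    outer p (x i - sampleMean x n) (x i - sampleMean x n))

variable {p : ℕ}

lemma avg_clm_apply {E F : Type*} [NormedAddCommGroup E] [NormedSpace ℝ E] [NormedAddCommGroup F]
    [NormedSpace ℝ F] (n : ℕ) (f : ℕ → E →L[ℝ] F) (y : E) :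
    avg n f y = avg n (fun i => f i y) := by
  simp [avg]

lemma sampleCov_apply (x : ℕ → Vec p) (n : ℕ) (y : Vec p) :
    sampleCov x n y =
      avg n (fun i => inner ℝ (x i - sampleMean x n) y • (x i - sampleMean x n)) := by
  simp only [sampleCov, avg_clm_apply, outer_apply]

lemma sampleThird_apply (x : ℕ → Vec p) (n : ℕ) (y z : Vec p) :
    sampleThird x n y z = avg n (fun i => (inner ℝ (x i - sampleMean x n) y *
      inner ℝ (x i - sampleMean x n) z) • (x i - sampleMean x n)) := by
  simp only [sampleThird, avg_clm_apply, smul_apply, outer_apply, smul_smul]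

lemma inner_avg (n : ℕ) (f : ℕ → Vec p) (y : Vec p) :
    inner ℝ (avg n f) y = avg n (fun i => inner ℝ (f i) y) := by
  simp [avg, inner_smul_left, sum_inner]

lemma sampleMoment_two (x : ℕ → Vec p) (n : ℕ) (u : Vec p) :
    sampleMoment x n 2 u = inner ℝ (sampleCov x n u) u := by
  simp only [sampleCov_apply, inner_avg, inner_smul_left, sampleMoment]
  simp [avg, real_inner_comm u, pow_two]

lemma sampleMoment_three (x : ℕ → Vec p) (n : ℕ) (u : Vec p) :
    sampleMoment x n 3 u = inner ℝ (sampleThird x n u u) u := by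
  simp only [sampleThird_apply, inner_avg, inner_smul_left, sampleMoment]
  simp [avg, real_inner_comm u, pow_succ]

lemma sampleThird_symm (x : ℕ → Vec p) (n : ℕ) (y z : Vec p) :
    sampleThird x n y z = sampleThird x n z y := by
  simp [sampleThird_apply, mul_comm]

lemma sampleThird_add (x : ℕ → Vec p) (n : ℕ) (y z w : Vec p) :
    sampleThird x n (y + z) w = sampleThird x n y w + sampleThird x n z w := by
  rw [sampleThird_symm, map_add, sampleThird_symm x n w, sampleThird_symm x n w]

lemma sampleCov_inner_symm (x : ℕ → Vec p) (n : ℕ) (y z : Vec p) :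
    inner ℝ (sampleCov x n y) z = inner ℝ (sampleCov x n z) y := by
  simp [sampleCov_apply, inner_avg, inner_smul_left, mul_comm]

lemma sampleThird_inner_symm (x : ℕ → Vec p) (n : ℕ) (y z w : Vec p) :
    inner ℝ (sampleThird x n y z) w = inner ℝ (sampleThird x n y w) z := by
  simp only [sampleThird_apply, inner_avg, real_inner_smul_left, mul_assoc]
  simp only [mul_comm (inner ℝ _ z)]

/-! ### Translation invariance of the central moments. -/

section centering

lemma sub_sampleMean {n : ℕ} (hn : n ≠ 0) (x : ℕ → Vec p) (m : Vec p) (i : ℕ) :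
    x i - sampleMean x n = (x i - m) - avg n (fun j => x j - m) := by
  rw [avg_sub_const hn, show sampleMean x n = avg n x from rfl]; abel

lemma inner_sub_sampleMean {n : ℕ} (hn : n ≠ 0) (x : ℕ → Vec p) (m : Vec p) (i : ℕ) (y : Vec p) :
    inner ℝ (x i - sampleMean x n) y =
      inner ℝ (x i - m) y - avg n (fun j => inner ℝ (x j - m) y) := by
  rw [sub_sampleMean hn x m, inner_sub_left, inner_avg]

/-- Replacing the random centre by a fixed `m` leaves only averages of functions of single
observations, to which the law of large numbers and the central limit theorem apply. -/
lemma sampleCov_apply_eq {n : ℕ} (hn : n ≠ 0) (x : ℕ → Vec p) (m y : Vec p) :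
    sampleCov x n y = avg n (fun i => inner ℝ (x i - m) y • (x i - m)) -
      avg n (fun i => inner ℝ (x i - m) y) • avg n (fun i => x i - m) := by
  rw [sampleCov_apply, ← avg_centered_smul hn]
  simp only [inner_sub_sampleMean hn x m]
  simp only [sub_sampleMean hn x m]

lemma sampleThird_apply_eq {n : ℕ} (hn : n ≠ 0) (x : ℕ → Vec p) (m y z : Vec p) :
    sampleThird x n y z = avg n (fun i => (inner ℝ (x i - m) y * inner ℝ (x i - m) z) • (x i - m))
      - avg n (fun i => inner ℝ (x i - m) y) • avg n (fun i => inner ℝ (x i - m) z • (x i - m))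
      - avg n (fun i => inner ℝ (x i - m) z) • avg n (fun i => inner ℝ (x i - m) y • (x i - m))
      - avg n (fun i => inner ℝ (x i - m) y * inner ℝ (x i - m) z) • avg n (fun i => x i - m)
      + (2 * avg n (fun i => inner ℝ (x i - m) y) * avg n (fun i => inner ℝ (x i - m) z)) •
        avg n (fun i => x i - m) := by
  rw [sampleThird_apply, ← avg_centered_mul_smul hn]
  simp only [inner_sub_sampleMean hn x m]
  simp only [sub_sampleMean hn x m]

end centering

/-- The first three moments of the sample `x`, centered at `m`, converge to `0`, `T₂`, `T₃`. -/
structure MomentsConverge (x : ℕ → Vec p) (m : Vec p) (T₂ : Vec p →L[ℝ] Vec p)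
    (T₃ : Vec p →L[ℝ] Vec p →L[ℝ] Vec p) : Prop where
  mean : Tendsto (fun n => avg n (fun i => x i - m)) atTop (𝓝 0)
  second : Tendsto (fun n => avg n (fun i => outer p (x i - m) (x i - m))) atTop (𝓝 T₂)
  third : Tendsto (fun n => avg n (fun i => outerCube (x i - m))) atTop (𝓝 T₃)

/-! ### Limits of the sample moment operators. -/

section limits

variable {x : ℕ → Vec p} {m : Vec p} {T₂ : Vec p →L[ℝ] Vec p} {T₃ : Vec p →L[ℝ] Vec p →L[ℝ] Vec p}
  {l : Filter ℕ}

lemma MomentsConverge.tendsto_sampleCov (h : MomentsConverge x m T₂ T₃) :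
    Tendsto (sampleCov x) atTop (𝓝 T₂) := by
  have h0 : Tendsto (fun n => avg n (fun i => outer p (x i - m) (x i - m)) -
      outer p (avg n (fun i => x i - m)) (avg n (fun i => x i - m))) atTop (𝓝 (T₂ - 0)) := by
    refine h.second.sub ?_
    have := ((by fun_prop : Continuous (fun y : Vec p => outer p y y)).tendsto 0).comp h.mean
    simpa [Function.comp_def] using this
  rw [sub_zero] at h0
  refine h0.congr' ?_
  filter_upwards [eventually_ne_atTop 0] with n hn
  ext1 y
  rw [sampleCov_apply_eq hn x m]
  simp only [sub_apply, avg_clm_apply, outer_apply, inner_avg]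

lemma tendsto_clm_apply {ι E F : Type*} [NormedAddCommGroup E] [NormedSpace ℝ E]
    [NormedAddCommGroup F] [NormedSpace ℝ F] {l : Filter ι} {f : ι → E →L[ℝ] F} {T : E →L[ℝ] F}
    {v : ι → E} {y : E} (hf : Tendsto f l (𝓝 T)) (hv : Tendsto v l (𝓝 y)) :
    Tendsto (fun n => f n (v n)) l (𝓝 (T y)) :=
  (isBoundedBilinearMap_apply.continuous.tendsto (T, y)).comp (hf.prodMk_nhds hv)

/-- Every correction term contains the centred mean, which tends to `0`. The filter `l` is general
so that the result also serves along the ultrafilters of the compactness argument. -/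
lemma MomentsConverge.tendsto_sampleThird (h : MomentsConverge x m T₂ T₃) (hl : l ≤ atTop)
    {v : ℕ → Vec p} {y : Vec p} (hv : Tendsto v l (𝓝 y)) :
    Tendsto (fun n => sampleThird x n (v n)) l (𝓝 (T₃ y)) := by
  have h1 := h.mean.mono_left hl
  have h2 := h.second.mono_left hl
  have h3 := h.third.mono_left hl
  set z : ℕ → Vec p := fun n => avg n (fun i => x i - m)
  set B : ℕ → Vec p →L[ℝ] Vec p := fun n => avg n (fun i => outer p (x i - m) (x i - m))
  set C : ℕ → Vec p →L[ℝ] Vec p →L[ℝ] Vec p := fun n => avg n (fun i => outerCube (x i - m))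
  have h0 : Tendsto (fun n => C n (v n) - inner ℝ (z n) (v n) • B n - outer p (B n (v n)) (z n)
      - outer p (z n) (B n (v n)) + (2 * inner ℝ (z n) (v n)) • outer p (z n) (z n)) l
      (𝓝 (T₃ y - inner ℝ 0 y • T₂ - outer p (T₂ y) 0 - outer p 0 (T₂ y)
        + (2 * inner ℝ 0 y) • outer p 0 0)) := by
    have hz : Tendsto (fun n => outer p (z n)) l (𝓝 (outer p 0)) :=
      ((outer p).continuous.tendsto 0).comp h1
    have hBv := tendsto_clm_apply h2 hv
    have hB : Tendsto (fun n => outer p (B n (v n))) l (𝓝 (outer p (T₂ y))) :=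
      ((outer p).continuous.tendsto _).comp hBv
    exact ((((tendsto_clm_apply h3 hv).sub ((h1.inner hv).smul h2)).sub
      (tendsto_clm_apply hB h1)).sub (tendsto_clm_apply hz hBv)).add
      (((h1.inner hv).const_mul 2).smul (tendsto_clm_apply hz h1))
  have hlim : T₃ y - inner ℝ 0 y • T₂ - outer p (T₂ y) 0 - outer p 0 (T₂ y)
        + (2 * inner ℝ 0 y) • outer p 0 0 = T₃ y := by
    ext1 w; simp
  rw [hlim] at h0
  refine h0.congr' ?_
  filter_upwards [hl (eventually_ne_atTop 0)] with n hn
  ext1 w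
  rw [sampleThird_apply_eq hn x m]
  simp only [z, B, C, sub_apply, add_apply, smul_apply, avg_clm_apply, outer_apply,
    outerCube_apply, inner_avg, real_inner_smul_left, smul_smul]

end limits

/-! ### First order condition -/

lemma sampleMoment_smul (x : ℕ → Vec p) (n k : ℕ) (t : ℝ) (u : Vec p) :
    sampleMoment x n k (t • u) = t ^ k * sampleMoment x n k u := by
  simp only [sampleMoment, real_inner_smul_left, mul_pow, ← Finset.mul_sum]
  ring

lemma sampleMoment_two_nonneg (x : ℕ → Vec p) (n : ℕ) (u : Vec p) : 0 ≤ sampleMoment x n 2 u := by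
  unfold sampleMoment; positivity

/-- A sum of squares vanishes only termwise. This covers directions of zero variance, where the
skewness quotient is a junk value. -/
lemma sampleMoment_three_eq_zero {x : ℕ → Vec p} {n : ℕ} {u : Vec p}
    (h : sampleMoment x n 2 u = 0) : sampleMoment x n 3 u = 0 := by
  unfold sampleMoment at *
  rcases mul_eq_zero.1 h with h | h
  · simp [h]
  · rw [Finset.sum_eq_zero_iff_of_nonneg fun i _ => by positivity] at h
    rw [Finset.sum_eq_zero, mul_zero]
    intro i hi
    rw [pow_eq_zero_iff two_ne_zero |>.1 (h i hi)]
    simp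

lemma sampleSkewness_sq (x : ℕ → Vec p) (n : ℕ) (u : Vec p) :
    sampleSkewness x n u ^ 2 = sampleMoment x n 3 u ^ 2 / sampleMoment x n 2 u ^ 3 := by
  rw [sampleSkewness, div_pow, ← Real.rpow_natCast (_ ^ (3 / 2 : ℝ)),
    ← Real.rpow_mul (sampleMoment_two_nonneg x n u), ← Real.rpow_natCast _ 3]
  norm_num

/-- Both sides have degree 6 in `y`, so maximality on the sphere extends to all vectors. The form
without denominators removes the constraint and passes to limits. -/
lemma IsSkewnessMaximizer.mul_le {x : ℕ → Vec p} {n : ℕ} {v : Vec p}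
    (hv : IsSkewnessMaximizer x n v) (y : Vec p) :
    sampleMoment x n 3 y ^ 2 * sampleMoment x n 2 v ^ 3 ≤
      sampleMoment x n 3 v ^ 2 * sampleMoment x n 2 y ^ 3 := by
  have h2 := sampleMoment_two_nonneg x n
  rcases (h2 v).eq_or_lt with hv0 | hv0
  · rw [← hv0, zero_pow three_ne_zero, mul_zero]
    have := h2 y
    positivity
  rcases (h2 y).eq_or_lt with hy0 | hy0
  · rw [sampleMoment_three_eq_zero hy0.symm, ← hy0]; simp
  have hy : y ≠ 0 := by
    rintro rfl
    simp [sampleMoment] at hy0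
  have hn : 0 < ‖y‖ := norm_pos_iff.2 hy
  have key := hv.2 (show ‖y‖⁻¹ • y ∈ Metric.sphere (0 : Vec p) 1 by
    simp [norm_smul, hn.ne'])
  simp only [Set.mem_ofPred_eq, sampleSkewness_sq, sampleMoment_smul] at key
  have e : (‖y‖⁻¹ ^ 3 * sampleMoment x n 3 y) ^ 2 / (‖y‖⁻¹ ^ 2 * sampleMoment x n 2 y) ^ 3 =
      sampleMoment x n 3 y ^ 2 / sampleMoment x n 2 y ^ 3 := by
    field_simp
  rwa [e, div_le_div_iff₀ (by positivity) (by positivity)] at key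

lemma IsSkewnessMaximizer.neg {x : ℕ → Vec p} {n : ℕ} {v : Vec p}
    (hv : IsSkewnessMaximizer x n v) : IsSkewnessMaximizer x n (-v) := by
  have e : sampleSkewness x n (-v) ^ 2 = sampleSkewness x n v ^ 2 := by
    simp only [sampleSkewness_sq, ← neg_one_smul ℝ v, sampleMoment_smul]
    ring
  refine ⟨by simpa using hv.1, fun y hy => ?_⟩
  have := hv.2 hy
  simp only [Set.mem_ofPred_eq] at this ⊢
  rwa [e]

lemma inner_sampleCov_add_smul (x : ℕ → Vec p) (n : ℕ) (v z : Vec p) (t : ℝ) :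
    inner ℝ (sampleCov x n (v + t • z)) (v + t • z) = inner ℝ (sampleCov x n v) v
      + 2 * inner ℝ (sampleCov x n v) z * t + inner ℝ (sampleCov x n z) z * t ^ 2 := by
  simp only [map_add, map_smul, inner_add_left, inner_add_right, real_inner_smul_left,
    real_inner_smul_right, sampleCov_inner_symm x n z v]
  ring

lemma inner_sampleThird_add_smul (x : ℕ → Vec p) (n : ℕ) (v z : Vec p) (t : ℝ) :
    inner ℝ (sampleThird x n (v + t • z) (v + t • z)) (v + t • z) =
      inner ℝ (sampleThird x n v v) v + 3 * inner ℝ (sampleThird x n v v) z * t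
      + 3 * inner ℝ (sampleThird x n z z) v * t ^ 2 + inner ℝ (sampleThird x n z z) z * t ^ 3 := by
  have hs : ∀ w, sampleThird x n (t • z) w = t • sampleThird x n z w := fun w => by
    rw [sampleThird_symm, map_smul, sampleThird_symm]
  simp only [sampleThird_add, hs, map_add, map_smul, inner_add_left, inner_add_right,
    real_inner_smul_left, real_inner_smul_right, smul_add]
  rw [sampleThird_inner_symm x n v z v, sampleThird_symm x n z v,
    sampleThird_inner_symm x n v z v, sampleThird_inner_symm x n v z z,
    sampleThird_symm x n v z, sampleThird_inner_symm x n z v z]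
  ring

/-- By `IsSkewnessMaximizer.mul_le`, perturbing `v` in any direction `z` without constraint cannot
increase the cross-multiplied objective, so its derivative there vanishes; testing all `z` gives the
vector equation. -/
lemma IsSkewnessMaximizer.first_order {x : ℕ → Vec p} {n : ℕ} {v : Vec p}
    (hv : IsSkewnessMaximizer x n v) (h2 : inner ℝ (sampleCov x n v) v ≠ 0)
    (h3 : inner ℝ (sampleThird x n v v) v ≠ 0) :
    inner ℝ (sampleCov x n v) v • sampleThird x n v v =
      inner ℝ (sampleThird x n v v) v • sampleCov x n v := by
  refine ext_inner_right ℝ fun z => ?_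
  rw [real_inner_smul_left, real_inner_smul_left]
  set B := inner ℝ (sampleCov x n v) v
  set C := inner ℝ (sampleThird x n v v) v
  set B₁ := inner ℝ (sampleCov x n v) z
  set C₁ := inner ℝ (sampleThird x n v v) z
  set B₂ := inner ℝ (sampleCov x n z) z
  set C₂ := inner ℝ (sampleThird x n z z) v
  set C₃ := inner ℝ (sampleThird x n z z) z
  -- The difference of the two sides of `mul_le` at `v + t z`, a polynomial in `t` that is
  -- nonpositive and zero at `t = 0`.
  let φ : ℝ → ℝ := fun t => (C + 3 * C₁ * t + 3 * C₂ * t ^ 2 + C₃ * t ^ 3) ^ 2 * B ^ 3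
    - C ^ 2 * (B + 2 * B₁ * t + B₂ * t ^ 2) ^ 3
  have hφ : HasDerivAt φ (2 * C * (3 * C₁) * B ^ 3 - C ^ 2 * (3 * B ^ 2 * (2 * B₁))) 0 := by
    have hid := hasDerivAt_id (0 : ℝ)
    have h := ((((((hasDerivAt_const (0 : ℝ) C).add (hid.const_mul (3 * C₁))).add
      ((hid.pow 2).const_mul (3 * C₂))).add ((hid.pow 3).const_mul C₃)).pow 2).mul_const (B ^ 3)).sub
      (((((hasDerivAt_const (0 : ℝ) B).add (hid.const_mul (2 * B₁))).add
      ((hid.pow 2).const_mul B₂)).pow 3).const_mul (C ^ 2))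
    convert! h using 1
    simp
  have hmax : IsLocalMax φ 0 := by
    refine Eventually.of_forall fun t => ?_
    have := hv.mul_le (v + t • z)
    rw [sampleMoment_three, sampleMoment_three, sampleMoment_two, sampleMoment_two,
      inner_sampleCov_add_smul, inner_sampleThird_add_smul] at this
    simp only [φ]
    simp only [mul_zero, add_zero, ne_eq, OfNat.ofNat_ne_zero, not_false_eq_true, zero_pow,
      sub_self]
    linarith
  have h0 := hmax.hasDerivAt_eq_zero hφ
  have h1 : (6 * C * B ^ 2) * (B * C₁ - C * B₁) = 0 := by linear_combination h0
  have h6 : 6 * C * B ^ 2 ≠ 0 := by positivity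
  have := (mul_eq_zero.1 h1).resolve_left h6
  linarith

/-! ### Consistency and linearization of maximizers -/

/-- A positive definite symmetric operator `A` with inverse `R`, and a nonzero vector `h`. -/
structure PopModel (A R : Vec p →L[ℝ] Vec p) (h : Vec p) : Prop where
  symm : ∀ y z, inner ℝ (A y) z = inner ℝ y (A z)
  pos : ∀ y, y ≠ 0 → 0 < inner ℝ (A y) y
  right_inv : ∀ y, A (R y) = y
  left_inv : ∀ y, R (A y) = y
  ne_zero : h ≠ 0

/-- The direction of `R h`. -/
noncomputable def unitDir (R : Vec p →L[ℝ] Vec p) (h : Vec p) : Vec p := ‖R h‖⁻¹ • R h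

/-- The orthogonal projection along the unit vector `u`. -/
noncomputable def projAlong (u : Vec p) : Vec p →L[ℝ] Vec p :=
  ContinuousLinearMap.id ℝ (Vec p) - outer p u u

@[simp] lemma projAlong_apply (u y : Vec p) : projAlong u y = y - inner ℝ u y • u := rfl

/-- The second moment operator of a two component mixture. -/
noncomputable def popSecond (A : Vec p →L[ℝ] Vec p) (h : Vec p) (β : ℝ) : Vec p →L[ℝ] Vec p :=
  A + β • outer p h h

/-- The third moment operator of a two component mixture. -/
noncomputable def popThird (h : Vec p) (c : ℝ) : Vec p →L[ℝ] Vec p →L[ℝ] Vec p := c • outerCube h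

lemma popSecond_apply (A : Vec p →L[ℝ] Vec p) (h : Vec p) (β : ℝ) (y : Vec p) :
    popSecond A h β y = A y + (β * inner ℝ h y) • h := by
  simp [popSecond, smul_smul]

lemma popThird_apply (h : Vec p) (c : ℝ) (y z : Vec p) :
    popThird h c y z = (c * inner ℝ h y * inner ℝ h z) • h := by
  simp [popThird, smul_smul, mul_assoc]

namespace PopModel

variable {A R : Vec p →L[ℝ] Vec p} {h : Vec p}

lemma theta_ne_zero (M : PopModel A R h) : R h ≠ 0 := fun h0 => by
  have := M.right_inv h
  rw [h0, map_zero] at this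
  exact M.ne_zero this.symm

lemma norm_pos (M : PopModel A R h) : 0 < ‖R h‖ := norm_pos_iff.2 M.theta_ne_zero

lemma tau_pos (M : PopModel A R h) : 0 < inner ℝ h (R h) := by
  have := M.pos _ M.theta_ne_zero
  rwa [M.right_inv] at this

lemma norm_unitDir (M : PopModel A R h) : ‖unitDir R h‖ = 1 := by
  simp [unitDir, norm_smul, M.norm_pos.ne']

lemma inner_unitDir (_ : PopModel A R h) : inner ℝ h (unitDir R h) = inner ℝ h (R h) / ‖R h‖ := by
  rw [unitDir, real_inner_smul_right]; field_simp

lemma map_unitDir (M : PopModel A R h) : A (unitDir R h) = ‖R h‖⁻¹ • h := by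
  rw [unitDir, map_smul, M.right_inv]

lemma proj_theta (M : PopModel A R h) : projAlong (unitDir R h) (R h) = 0 := by
  have := M.norm_pos
  simp only [projAlong_apply, unitDir, real_inner_smul_left, real_inner_self_eq_norm_sq, smul_smul]
  rw [show ‖R h‖⁻¹ * ‖R h‖ ^ 2 * ‖R h‖⁻¹ = 1 by field_simp, one_smul, sub_self]

/-- The only unit vector in the half space of `unitDir R h` with maximal squared population
skewness is `unitDir R h`. -/
lemma eq_unitDir (M : PopModel A R h) {β c : ℝ} (hβ : 0 ≤ β) (hc : c ≠ 0) {y : Vec p}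
    (hy : ‖y‖ = 1) (hpos : 0 ≤ inner ℝ y (unitDir R h))
    (hle : inner ℝ (popThird h c (unitDir R h) (unitDir R h)) (unitDir R h) ^ 2 *
        inner ℝ (popSecond A h β y) y ^ 3 ≤
      inner ℝ (popThird h c y y) y ^ 2 *
        inner ℝ (popSecond A h β (unitDir R h)) (unitDir R h) ^ 3) :
    y = unitDir R h := by
  have hN := M.norm_pos
  have hτ := M.tau_pos
  simp only [popSecond_apply, popThird_apply, inner_add_left, real_inner_smul_left, M.map_unitDir,
    M.inner_unitDir] at hle
  set N := ‖R h‖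
  set τ := inner ℝ h (R h)
  set s := inner ℝ h y with hs
  set q := inner ℝ (A y) y with hq
  have hq0 : 0 < q := M.pos y (by rintro rfl; simp at hy)
  -- Both sides are cubes up to a common positive factor, so the comparison reduces to the bases.
  -- There the `β` terms cancel.
  have h1 : (c ^ 2 / N ^ 6) * (τ ^ 2 * (q + β * s * s)) ^ 3 ≤
      (c ^ 2 / N ^ 6) * (s ^ 2 * (τ + β * τ ^ 2)) ^ 3 := by
    convert! hle using 1 <;> field_simp
  have h2 := le_of_mul_le_mul_left h1 (by positivity)
  have h3 : τ ^ 2 * (q + β * s * s) ≤ s ^ 2 * (τ + β * τ ^ 2) :=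
    le_of_pow_le_pow_left₀ three_ne_zero (by positivity) h2
  have h4 : τ * q ≤ s ^ 2 := by
    have : τ * (τ * q) ≤ τ * s ^ 2 := by nlinarith
    exact le_of_mul_le_mul_left this hτ
  -- Equality case of Cauchy-Schwarz: the squared `A`-norm of this vector is `(τ q - s²) / τ`, which
  -- `h4` makes nonpositive.
  have hk : y - (s / τ) • R h = 0 := by
    by_contra hne
    have := M.pos _ hne
    have hAy : inner ℝ (A y) (R h) = s := by
      rw [M.symm, M.right_inv, real_inner_comm]
    simp only [map_sub, map_smul, M.right_inv, inner_sub_left, inner_sub_right,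
      real_inner_smul_left, real_inner_smul_right, hAy, ← hs, ← hq] at this
    have e : q - s / τ * s - (s / τ * s - s / τ * (s / τ * inner ℝ h (R h))) = (τ * q - s ^ 2) / τ := by
      change q - s / τ * s - (s / τ * s - s / τ * (s / τ * τ)) = _
      field_simp
      ring
    have e2 : q - s / τ * s - (s / τ * s - s / τ * (s / τ * inner ℝ h (R h))) ≤ 0 := by
      rw [e]; exact div_nonpos_of_nonpos_of_nonneg (by linarith) hτ.le
    linarith
  have hy' : y = (s / τ * N) • unitDir R h := by
    rw [unitDir, smul_smul, mul_assoc, mul_inv_cancel₀ hN.ne', mul_one]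
    exact sub_eq_zero.1 hk
  have hcoef : |s / τ * N| = 1 := by
    rw [hy', norm_smul, M.norm_unitDir, mul_one] at hy
    exact hy
  have hcoef' : 0 ≤ s / τ * N := by
    rw [hy', real_inner_smul_left, real_inner_self_eq_norm_sq, M.norm_unitDir] at hpos
    simpa using hpos
  rw [abs_of_nonneg hcoef'] at hcoef
  rw [hy', hcoef, one_smul]

end PopModel

section consistency

variable {A R : Vec p →L[ℝ] Vec p} {h m : Vec p} {β c : ℝ} {x v : ℕ → Vec p}

/-- Along an ultrafilter converging to a cluster point, `mul_le` against `unitDir R h` passes to the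
limit and `PopModel.eq_unitDir` identifies the point. Uniqueness of cluster points in the compact
half sphere gives convergence. -/
lemma tendsto_of_maximizers (M : PopModel A R h) (hβ : 0 ≤ β) (hc : c ≠ 0)
    (hx : MomentsConverge x m (popSecond A h β) (popThird h c))
    (hv : ∀ᶠ n in atTop, IsSkewnessMaximizer x n (v n))
    (hpos : ∀ᶠ n in atTop, 0 ≤ inner ℝ (v n) (unitDir R h)) :
    Tendsto v atTop (𝓝 (unitDir R h)) := by
  have hK : IsCompact (Metric.sphere (0 : Vec p) 1 ∩ {y | 0 ≤ inner ℝ y (unitDir R h)}) :=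
    (isCompact_sphere _ _).inter_right (isClosed_le continuous_const (by fun_prop))
  refine hK.tendsto_nhds_of_unique_mapClusterPt ?_ ?_
  · filter_upwards [hv, hpos] with n h1 h2 using ⟨h1.1, h2⟩
  · rintro y ⟨hy, hy0⟩ hcl
    obtain ⟨U, hU, hUy⟩ := mapClusterPt_iff_ultrafilter.1 hcl
    have hcov := hx.tendsto_sampleCov.mono_left hU
    have hth := hx.tendsto_sampleThird hU hUy
    have hcst := tendsto_const_nhds (x := unitDir R h) (f := (U : Filter ℕ))
    have hth0 := hx.tendsto_sampleThird hU hcst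
    refine M.eq_unitDir hβ hc (by simpa using hy) hy0 ?_
    refine le_of_tendsto_of_tendsto
      ((((tendsto_clm_apply hth0 hcst).inner hcst).pow 2).mul
        (((tendsto_clm_apply hcov hUy).inner hUy).pow 3))
      ((((tendsto_clm_apply hth hUy).inner hUy).pow 2).mul
        (((tendsto_clm_apply hcov hcst).inner hcst).pow 3)) ?_
    filter_upwards [hU hv] with n hn
    have := hn.mul_le (unitDir R h)
    simpa only [sampleMoment_two, sampleMoment_three] using this

/-- The leading term of the deviation of a maximizer `v` from the population direction. -/
noncomputable def score (R : Vec p →L[ℝ] Vec p) (h : Vec p) (x : ℕ → Vec p) (n : ℕ) (v : Vec p) :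
    Vec p :=
  projAlong (unitDir R h) (R (sampleMoment x n 2 v • sampleThird x n (unitDir R h) (unitDir R h)
    - sampleMoment x n 3 v • sampleCov x n (unitDir R h)))

/-- The third central moment of the population projected on `unitDir R h`. -/
noncomputable def popSkew (R : Vec p →L[ℝ] Vec p) (h : Vec p) (c : ℝ) : ℝ :=
  c * (inner ℝ h (R h) / ‖R h‖) ^ 3

/-- The variance of the population projected on `unitDir R h`. -/
noncomputable def popVar (R : Vec p →L[ℝ] Vec p) (h : Vec p) (β : ℝ) : ℝ :=
  (inner ℝ h (R h) + β * inner ℝ h (R h) ^ 2) / ‖R h‖ ^ 2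

lemma popSkew_ne_zero (M : PopModel A R h) (hc : c ≠ 0) : popSkew R h c ≠ 0 :=
  mul_ne_zero hc (pow_ne_zero _ (div_ne_zero M.tau_pos.ne' M.norm_pos.ne'))

lemma popVar_pos (M : PopModel A R h) (hβ : 0 ≤ β) : 0 < popVar R h β := by
  have := M.tau_pos
  have := M.norm_pos
  unfold popVar; positivity

lemma tendsto_sampleMoment_two (M : PopModel A R h)
    (hx : MomentsConverge x m (popSecond A h β) (popThird h c))
    (hv : Tendsto v atTop (𝓝 (unitDir R h))) :
    Tendsto (fun n => sampleMoment x n 2 (v n)) atTop (𝓝 (popVar R h β)) := by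
  have := (tendsto_clm_apply hx.tendsto_sampleCov hv).inner (𝕜 := ℝ) hv
  simp only [← sampleMoment_two] at this
  convert! this using 2
  have := M.norm_pos
  simp only [popSecond_apply, inner_add_left, real_inner_smul_left, M.map_unitDir,
    M.inner_unitDir, popVar]
  field_simp

lemma tendsto_sampleMoment_three (M : PopModel A R h)
    (hx : MomentsConverge x m (popSecond A h β) (popThird h c))
    (hv : Tendsto v atTop (𝓝 (unitDir R h))) :
    Tendsto (fun n => sampleMoment x n 3 (v n)) atTop (𝓝 (popSkew R h c)) := by
  have := (tendsto_clm_apply (hx.tendsto_sampleThird le_rfl hv) hv).inner (𝕜 := ℝ) hv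
  simp only [← sampleMoment_three] at this
  convert! this using 2
  simp only [popThird_apply, real_inner_smul_left, M.inner_unitDir, popSkew]
  ring

open Asymptotics in
-- The first-order condition makes the score exactly linear in `v n - u`, and its operator tends to
-- `c₃` times the projection off `u`. The remaining component along `u` is quadratically small on
-- the sphere.
lemma isEquivalent_score (M : PopModel A R h) (hβ : 0 ≤ β) (hc : c ≠ 0)
    (hx : MomentsConverge x m (popSecond A h β) (popThird h c))
    (hv : ∀ᶠ n in atTop, IsSkewnessMaximizer x n (v n))
    (hlim : Tendsto v atTop (𝓝 (unitDir R h))) :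
    (fun n => v n - unitDir R h) ~[atTop]
      (fun n => (popSkew R h c)⁻¹ • score R h x n (v n)) := by
  have hc3 := popSkew_ne_zero M hc
  have hb2 := popVar_pos M hβ
  have hB := tendsto_sampleMoment_two M hx hlim
  have hC := tendsto_sampleMoment_three M hx hlim
  set u := unitDir R h with hu
  set c₃ := popSkew R h c
  set b₂ := popVar R h β
  set Γ : Vec p →L[ℝ] Vec p := (projAlong u).comp R
  have hΓh : Γ h = 0 := M.proj_theta
  let N : ℕ → Vec p →L[ℝ] Vec p := fun n => Γ.comp (sampleMoment x n 3 (v n) • sampleCov x n -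
    sampleMoment x n 2 (v n) • sampleThird x n (u + v n))
  -- The terms of the limit with range spanned by `h` are killed by `Γ`; only `c₃ Γ A` survives, and
  -- `R A` is the identity.
  have hN : Tendsto N atTop (𝓝 (c₃ • projAlong u)) := by
    have h1 : Tendsto (fun n => sampleMoment x n 3 (v n) • sampleCov x n -
        sampleMoment x n 2 (v n) • sampleThird x n (u + v n)) atTop
        (𝓝 (c₃ • popSecond A h β - b₂ • popThird h c (u + u))) :=
      (hC.smul hx.tendsto_sampleCov).sub
        (hB.smul (hx.tendsto_sampleThird le_rfl (tendsto_const_nhds.add hlim)))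
    have h2 : Tendsto N atTop (𝓝 (Γ.comp (c₃ • popSecond A h β - b₂ • popThird h c (u + u)))) :=
      ((by fun_prop : Continuous fun T : Vec p →L[ℝ] Vec p => Γ.comp T).tendsto _).comp h1
    convert! h2 using 2
    ext1 y
    have hΓA : Γ (A y) = projAlong u y := by
      change projAlong u (R (A y)) = _
      rw [M.left_inv]
    rw [ContinuousLinearMap.comp_apply, sub_apply, smul_apply, smul_apply, smul_apply,
      popSecond_apply, popThird_apply, map_sub, map_smul, map_smul, map_add, map_smul, map_smul,
      hΓh, hΓA]
    simp
  have hscore : ∀ᶠ n in atTop, score R h x n (v n) = N n (v n - u) := by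
    filter_upwards [hv, hB.eventually_ne hb2.ne', hC.eventually_ne hc3] with n hn h2 h3
    have hfo := hn.first_order (by rwa [← sampleMoment_two]) (by rwa [← sampleMoment_three])
    rw [← sampleMoment_two, ← sampleMoment_three] at hfo
    -- Symmetry gives the difference of squares `T₃(v,v) - T₃(u,u) = T₃(u + v, v - u)`; the terms at
    -- `v` cancel by `hfo`.
    have e : sampleMoment x n 2 (v n) • sampleThird x n u u - sampleMoment x n 3 (v n) •
        sampleCov x n u = (sampleMoment x n 3 (v n) • sampleCov x n -
        sampleMoment x n 2 (v n) • sampleThird x n (u + v n)) (v n - u) := by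
      rw [sub_apply, smul_apply, smul_apply, map_sub, map_sub, sampleThird_add, sampleThird_add,
        sampleThird_symm x n (v n) u]
      simp only [smul_sub, smul_add, hfo]
      abel
    exact congrArg Γ e
  have hd : Tendsto (fun n => v n - u) atTop (𝓝 0) := by
    simpa using hlim.sub_const u
  have hfin : (fun n => score R h x n (v n) - c₃ • (v n - u)) =o[atTop] fun n => v n - u := by
    have hg : Tendsto (fun n => ‖N n - c₃ • projAlong u‖ + |c₃| / 2 * ‖v n - u‖) atTop (𝓝 0) := by
      simpa using (hN.sub_const (c₃ • projAlong u)).norm.add (hd.norm.const_mul (|c₃| / 2))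
    refine isLittleO_iff.2 fun ε hε => ?_
    filter_upwards [hscore, hv, hg.eventually_le_const hε] with n hn hmax hle
    have hvn : ‖v n‖ = 1 := by simpa using hmax.1
    have hun : ‖u‖ = 1 := M.norm_unitDir
    -- For unit vectors the component of `v - u` along `u` is of second order.
    have hin : inner ℝ u (v n - u) = -(‖v n - u‖ ^ 2 / 2) := by
      rw [norm_sub_sq_real, inner_sub_right, real_inner_self_eq_norm_sq, hvn, hun,
        real_inner_comm]
      ring
    have e : score R h x n (v n) - c₃ • (v n - u) =
        (N n - c₃ • projAlong u) (v n - u) + (c₃ * (‖v n - u‖ ^ 2 / 2)) • u := by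
      rw [hn, sub_apply, smul_apply, projAlong_apply, hin]
      module
    rw [e]
    calc _ ≤ ‖N n - c₃ • projAlong u‖ * ‖v n - u‖ + |c₃| * (‖v n - u‖ ^ 2 / 2) := by
          refine (norm_add_le _ _).trans (add_le_add (ContinuousLinearMap.le_opNorm _ _) ?_)
          rw [norm_smul, hun, mul_one, norm_mul, Real.norm_eq_abs, Real.norm_eq_abs,
            abs_of_nonneg (by positivity : 0 ≤ ‖v n - u‖ ^ 2 / 2)]
      _ = (‖N n - c₃ • projAlong u‖ + |c₃| / 2 * ‖v n - u‖) * ‖v n - u‖ := by ring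
      _ ≤ ε * ‖v n - u‖ := by gcongr
  refine IsEquivalent.symm ?_
  refine (hfin.const_smul_left c₃⁻¹).congr_left fun n => ?_
  simp [smul_sub, smul_smul, hc3]

end consistency

/-! ### Convergence in distribution -/

section tools

variable {Ω Ω' : Type*} [MeasurableSpace Ω] {P : Measure Ω} [IsProbabilityMeasure P]
  [MeasurableSpace Ω'] {P' : Measure Ω'} [IsProbabilityMeasure P']

/-- The Cramér-Wold device at the level of characteristic functions. -/
lemma charFun_map_inner_one {p : ℕ} (μ : Measure (Vec p)) (t : Vec p) :
    charFun (μ.map (fun x => inner ℝ t x)) 1 = charFun μ t := by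
  rw [charFun_apply, charFun_apply, integral_map (by fun_prop) (by fun_prop)]
  simp [real_inner_comm]

/-- The multivariate central limit theorem for centered random vectors. -/
theorem tendstoInDistribution_multivariateGaussian {p : ℕ} {Y : ℕ → Ω → Vec p}
    (hindep : iIndepFun Y P) (hident : ∀ i, IdentDistrib (Y i) (Y 0) P P)
    (hmem : MemLp (Y 0) 2 P) {T : Matrix (Fin p) (Fin p) ℝ} (hT : T.PosSemidef)
    (hmean : ∀ t, ∫ ω, inner ℝ t (Y 0 ω) ∂P = 0)
    (hvar : ∀ t : Vec p, ∫ ω, inner ℝ t (Y 0 ω) ^ 2 ∂P = t.ofLp ⬝ᵥ T *ᵥ t.ofLp) :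
    TendstoInDistribution (fun (n : ℕ) ω => (√(n : ℝ))⁻¹ • ∑ i ∈ Finset.range n, Y i ω) atTop id
      (fun _ => P) (multivariateGaussian 0 T) := by
  have hmeas : ∀ n : ℕ, AEMeasurable (fun ω => (√(n : ℝ))⁻¹ • ∑ i ∈ Finset.range n, Y i ω) P :=
    fun n => (Finset.aemeasurable_fun_sum _ fun i _ => (hident i).aemeasurable_fst).fun_const_smul _
  refine ⟨hmeas, aemeasurable_id, ?_⟩
  refine ProbabilityMeasure.tendsto_iff_tendsto_charFun.2 fun t => ?_
  have hmt : AEMeasurable (fun ω => inner ℝ t (Y 0 ω)) P :=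
    (measurable_const.inner measurable_id).comp_aemeasurable (hident 0).aemeasurable_fst
  have hV : Var[fun ω => inner ℝ t (Y 0 ω); P] = t.ofLp ⬝ᵥ T *ᵥ t.ofLp := by
    rw [variance_eq_integral hmt, hmean t, ← hvar t]
    simp
  have hV0 : 0 ≤ t.ofLp ⬝ᵥ T *ᵥ t.ofLp := hV ▸ variance_nonneg _ _
  have key := tendstoInDistribution_inv_sqrt_mul_sum_sub (X := fun i ω => inner ℝ t (Y i ω))
    (P := P) (P' := gaussianReal 0 Var[fun ω => inner ℝ t (Y 0 ω); P].toNNReal) (Y := id)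
    HasLaw.id (hmem.const_inner t)
    (hindep.comp (fun _ y => inner ℝ t y) (fun _ => by fun_prop))
    (fun i => (hident i).comp (u := fun y => inner ℝ t y) (by fun_prop))
  have h1 := ProbabilityMeasure.tendsto_iff_tendsto_charFun.1 key.tendsto 1
  simp only [ProbabilityMeasure.coe_mk, Measure.map_id, charFun_gaussianReal, hmean, hV,
    Real.coe_toNNReal _ hV0] at h1
  simp only [ProbabilityMeasure.coe_mk, Measure.map_id, charFun_multivariateGaussian hT]
  convert! h1 using 2 with n
  · rw [← charFun_map_inner_one, AEMeasurable.map_map_of_aemeasurable (by fun_prop) (hmeas n)]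
    congr 2
    ext ω
    simp [real_inner_smul_right, inner_sum]
  · simp

/-- Portmanteau for the closed set `{ε ≤ ‖x‖}`, which is null for the Dirac mass at `0`. -/
lemma tendstoInMeasure_zero_of_tendstoInDistribution {E : Type*} [NormedAddCommGroup E]
    [MeasurableSpace E] [BorelSpace E] {X : ℕ → Ω → E}
    (h : TendstoInDistribution X atTop (fun _ : Ω' => (0 : E)) (fun _ => P) P') :
    TendstoInMeasure P X atTop (0 : Ω → E) := by
  rw [tendstoInMeasure_iff_norm]
  intro ε hε
  have hF : IsClosed {x : E | ε ≤ ‖x‖} := isClosed_le continuous_const continuous_norm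
  have h1 := ProbabilityMeasure.limsup_measure_closed_le_of_tendsto h.tendsto hF
  have h0 : (P'.map (fun _ : Ω' => (0 : E))) {x : E | ε ≤ ‖x‖} = 0 := by
    rw [Measure.map_apply measurable_const hF.measurableSet]
    simp [hε.not_ge]
  simp only [ProbabilityMeasure.coe_mk, h0] at h1
  have h2 : ∀ n, (P.map (X n)) {x : E | ε ≤ ‖x‖} = P {ω | ε ≤ ‖X n ω - (0 : Ω → E) ω‖} := by
    intro n
    rw [Measure.map_apply_of_aemeasurable (h.forall_aemeasurable n) hF.measurableSet]
    simp
  simp only [h2] at h1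
  exact tendsto_of_le_liminf_of_limsup_le bot_le h1

variable {E : Type*} [NormedAddCommGroup E] [NormedSpace ℝ E] [SecondCountableTopology E]
  [MeasurableSpace E] [BorelSpace E]

/-- A null sequence times a sequence converging in distribution is null in measure. -/
lemma tendstoInMeasure_smul {X : ℕ → Ω → E} {Z : Ω' → E} {c : ℕ → Ω → ℝ}
    (hX : TendstoInDistribution X atTop Z (fun _ => P) P')
    (hc : ∀ n, AEMeasurable (c n) P) (hc0 : ∀ᵐ ω ∂P, Tendsto (fun n => c n ω) atTop (𝓝 0)) :
    TendstoInMeasure P (fun n ω => c n ω • X n ω) atTop (0 : Ω → E) := by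
  refine tendstoInMeasure_zero_of_tendstoInDistribution (P' := P') ?_
  have := hX.continuous_comp_prodMk_of_tendstoInMeasure_const (g := fun q : E × ℝ => q.2 • q.1)
    (by fun_prop) (tendstoInMeasure_of_tendsto_ae (fun n => (hc n).aestronglyMeasurable) hc0) hc
  simpa using this

open Asymptotics in
/-- Almost surely asymptotically equivalent sequences have the same limit in distribution. -/
lemma tendstoInDistribution_of_isEquivalent {X D : ℕ → Ω → E} {Z : Ω' → E}
    (hX : TendstoInDistribution X atTop Z (fun _ => P) P')
    (hD : ∀ n, AEMeasurable (D n) P)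
    (h : ∀ᵐ ω ∂P, (fun n => D n ω) ~[atTop] (fun n => X n ω)) :
    TendstoInDistribution D atTop Z (fun _ => P) P' := by
  have hXm := hX.forall_aemeasurable
  -- Relative error, equal to `0` where `X n ω = 0` since `0⁻¹ = 0`. It tends to `0` almost surely,
  -- so Slutsky applies to `X + ‖X‖ q`.
  let q : ℕ → Ω → E := fun n ω => ‖X n ω‖⁻¹ • (D n ω - X n ω)
  have hq : ∀ n, AEMeasurable (q n) P := fun n =>
    (hXm n).norm.inv.smul ((hD n).sub (hXm n))
  have hq0 : ∀ᵐ ω ∂P, Tendsto (fun n => q n ω) atTop (𝓝 0) := by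
    filter_upwards [h] with ω hω
    rw [tendsto_zero_iff_norm_tendsto_zero, Metric.tendsto_nhds]
    intro ε hε
    filter_upwards [isLittleO_iff.1 hω.isLittleO (half_pos hε)] with n hn
    simp only [Pi.sub_apply] at hn
    rw [Real.dist_eq, sub_zero, abs_norm, norm_smul, norm_inv, norm_norm]
    refine lt_of_le_of_lt ?_ (half_lt_self hε)
    rcases (norm_nonneg (X n ω)).eq_or_lt with h0 | h0
    · rw [← h0, inv_zero, zero_mul]
      positivity
    · rwa [inv_mul_le_iff₀ h0, mul_comm]
  have h1 := hX.continuous_comp_prodMk_of_tendstoInMeasure_const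
    (g := fun r : E × E => r.1 + ‖r.1‖ • r.2) (by fun_prop)
    (tendstoInMeasure_of_tendsto_ae (fun n => (hq n).aestronglyMeasurable) hq0) hq
  simp only [smul_zero, add_zero] at h1
  refine tendstoInDistribution_of_tendstoInMeasure_sub D Z h1 ?_ hD
  refine tendstoInMeasure_of_tendsto_ae (fun n => ?_) ?_
  · exact ((hD n).sub (h1.forall_aemeasurable n)).aestronglyMeasurable
  · filter_upwards [h] with ω hω
    refine tendsto_const_nhds.congr' ?_
    filter_upwards [isLittleO_iff.1 hω.isLittleO one_pos] with n hn
    simp only [Pi.sub_apply, one_mul] at hn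
    simp only [Pi.sub_apply, Pi.zero_apply, q, smul_smul]
    -- Where `X` vanishes, the little-o bound with constant `1` forces `D` to vanish as well, so the
    -- representation by `q` is still exact.
    rcases eq_or_ne (X n ω) 0 with h0 | h0
    · rw [h0, norm_zero, sub_zero] at hn
      simp [h0, norm_le_zero_iff.1 hn]
    · rw [mul_inv_cancel₀ (norm_ne_zero_iff.2 h0), one_smul]
      abel

end tools

/-! ### Polynomial growth and Gaussian moments -/

/-- Continuous functions of at most polynomial growth. -/
def PolyGrowth {F : Type*} [NormedAddCommGroup F] (f : Vec p → F) : Prop :=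
  Continuous f ∧ ∃ (k : ℕ) (K : ℝ), 0 ≤ K ∧ ∀ x, ‖f x‖ ≤ K * (1 + ‖x‖) ^ k

namespace PolyGrowth

variable {F : Type*} [NormedAddCommGroup F]

lemma const (c : F) : PolyGrowth (fun _ : Vec p => c) :=
  ⟨continuous_const, 0, ‖c‖, norm_nonneg _, fun _ => by simp⟩

lemma add {f g : Vec p → F} (hf : PolyGrowth f) (hg : PolyGrowth g) :
    PolyGrowth (fun x => f x + g x) := by
  obtain ⟨hfc, k, K, hK, h1⟩ := hf
  obtain ⟨hgc, l, L, hL, h2⟩ := hg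
  refine ⟨hfc.add hgc, k + l, K + L, by positivity, fun x => ?_⟩
  have h1x : (1 : ℝ) ≤ 1 + ‖x‖ := by simp
  calc ‖f x + g x‖ ≤ K * (1 + ‖x‖) ^ k + L * (1 + ‖x‖) ^ l :=
        (norm_add_le _ _).trans (add_le_add (h1 x) (h2 x))
    _ ≤ K * (1 + ‖x‖) ^ (k + l) + L * (1 + ‖x‖) ^ (k + l) := by
        gcongr <;> first | exact h1x | simp
    _ = (K + L) * (1 + ‖x‖) ^ (k + l) := by ring

lemma comp_add {f : Vec p → F} (hf : PolyGrowth f) (m : Vec p) : PolyGrowth (fun x => f (m + x)) := by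
  obtain ⟨hfc, k, K, hK, h1⟩ := hf
  refine ⟨by fun_prop, k, K * (1 + ‖m‖) ^ k, by positivity, fun x => (h1 _).trans ?_⟩
  rw [mul_assoc, ← mul_pow]
  gcongr
  nlinarith [norm_add_le m x, norm_nonneg m, norm_nonneg x, mul_nonneg (norm_nonneg m) (norm_nonneg x)]

lemma norm_sq {f : Vec p → F} (hf : PolyGrowth f) : PolyGrowth (fun x => ‖f x‖ ^ 2) := by
  obtain ⟨hfc, k, K, hK, h1⟩ := hf
  refine ⟨by fun_prop, k * 2, K ^ 2, by positivity, fun x => ?_⟩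
  rw [norm_pow, norm_norm, pow_mul, ← mul_pow]
  gcongr
  exact h1 x

lemma integrable {f : Vec p → F} (hf : PolyGrowth f) (ν : Measure (Vec p)) [IsGaussian ν] :
    Integrable f ν := by
  obtain ⟨hfc, k, K, hK, h1⟩ := hf
  have h_integrable : Integrable (fun x : Vec p => K * (1 + ‖x‖) ^ k) ν := by
    refine Integrable.const_mul ?_ K
    have hm1 : MemLp (fun x : Vec p => ‖x‖) k ν := (IsGaussian.memLp_id ν k (by simp)).norm
    have hm2 : MemLp (fun _ : Vec p => (1 : ℝ)) k ν := memLp_const 1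
    have hm : MemLp (fun x : Vec p => 1 + ‖x‖) k ν := hm2.add hm1
    rcases eq_or_ne k 0 with rfl | hk
    · simp
    · have := hm.integrable_norm_pow hk
      refine this.congr (ae_of_all _ fun x => ?_)
      simp only
      rw [Real.norm_of_nonneg (by positivity)]
  refine h_integrable.mono' ?_ (ae_of_all _ h1)
  exact hfc.aestronglyMeasurable

variable [NormedSpace ℝ F] {G : Type*} [NormedAddCommGroup G] [NormedSpace ℝ G]

lemma clm (L : Vec p →L[ℝ] F) : PolyGrowth (fun x => L x) :=
  ⟨L.continuous, 1, ‖L‖, norm_nonneg _, fun x => (L.le_opNorm x).trans (by gcongr; simp)⟩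

lemma inner_const (y : Vec p) : PolyGrowth (fun x : Vec p => inner ℝ y x) := clm (innerSL ℝ y)

lemma bilin {H : Type*} [NormedAddCommGroup H] [NormedSpace ℝ H] (B : F →L[ℝ] G →L[ℝ] H)
    {f : Vec p → F} {g : Vec p → G} (hf : PolyGrowth f) (hg : PolyGrowth g) :
    PolyGrowth (fun x => B (f x) (g x)) := by
  obtain ⟨hfc, k, K, hK, h1⟩ := hf
  obtain ⟨hgc, l, L, hL, h2⟩ := hg
  refine ⟨by fun_prop, k + l, ‖B‖ * K * L, by positivity, fun x => ?_⟩
  calc ‖B (f x) (g x)‖ ≤ ‖B‖ * ‖f x‖ * ‖g x‖ := B.le_opNorm₂ _ _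
    _ ≤ ‖B‖ * (K * (1 + ‖x‖) ^ k) * (L * (1 + ‖x‖) ^ l) := by
        gcongr
        · exact h1 x
        · exact h2 x
    _ = ‖B‖ * K * L * (1 + ‖x‖) ^ (k + l) := by ring

lemma smul {f : Vec p → ℝ} {g : Vec p → F} (hf : PolyGrowth f) (hg : PolyGrowth g) :
    PolyGrowth (fun x => f x • g x) :=
  bilin (ContinuousLinearMap.lsmul ℝ ℝ) hf hg

lemma mul {f g : Vec p → ℝ} (hf : PolyGrowth f) (hg : PolyGrowth g) :
    PolyGrowth (fun x => f x * g x) := hf.smul hg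

lemma pow {f : Vec p → ℝ} (hf : PolyGrowth f) (k : ℕ) : PolyGrowth (fun x => f x ^ k) := by
  induction k with
  | zero => simpa using const (p := p) (1 : ℝ)
  | succ k ih => simpa [pow_succ] using ih.mul hf

end PolyGrowth

/-- The derivatives at `0` of the moment generating function of a centred Gaussian are its moments.
Each is the exponential times a polynomial, with `q ↦ v t q + q'` as recursion. -/
lemma iteratedDeriv_exp_sq (v : ℝ) :
    iteratedDeriv 1 (fun t : ℝ => Real.exp (v * t ^ 2 / 2)) 0 = 0 ∧
    iteratedDeriv 2 (fun t : ℝ => Real.exp (v * t ^ 2 / 2)) 0 = v ∧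
    iteratedDeriv 3 (fun t : ℝ => Real.exp (v * t ^ 2 / 2)) 0 = 0 ∧
    iteratedDeriv 4 (fun t : ℝ => Real.exp (v * t ^ 2 / 2)) 0 = 3 * v ^ 2 := by
  have hE : ∀ t : ℝ, HasDerivAt (fun t : ℝ => Real.exp (v * t ^ 2 / 2))
      (Real.exp (v * t ^ 2 / 2) * (v * t)) t := fun t => by
    convert! ((((hasDerivAt_id t).pow 2).const_mul v).div_const 2).exp using 1
    simp; ring
  have step : ∀ (q q' : ℝ → ℝ), (∀ t, HasDerivAt q (q' t) t) →
      deriv (fun t : ℝ => Real.exp (v * t ^ 2 / 2) * q t) =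
        fun t => Real.exp (v * t ^ 2 / 2) * (v * t * q t + q' t) := fun q q' hq => by
    ext t
    refine ((hE t).fun_mul (hq t)).deriv.trans ?_
    ring
  have d1 : iteratedDeriv 1 (fun t : ℝ => Real.exp (v * t ^ 2 / 2)) =
      fun t => Real.exp (v * t ^ 2 / 2) * (v * t) := by
    rw [iteratedDeriv_one]; ext t; exact (hE t).deriv
  have d2 : iteratedDeriv 2 (fun t : ℝ => Real.exp (v * t ^ 2 / 2)) =
      fun t => Real.exp (v * t ^ 2 / 2) * (v * t * (v * t) + v) := by
    rw [iteratedDeriv_succ, d1]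
    exact step _ (fun _ => v) fun t => by simpa using (hasDerivAt_id t).const_mul v
  have d3 : iteratedDeriv 3 (fun t : ℝ => Real.exp (v * t ^ 2 / 2)) =
      fun t => Real.exp (v * t ^ 2 / 2) * (v * t * (v * t * (v * t) + v) + 2 * v ^ 2 * t) := by
    rw [iteratedDeriv_succ, d2]
    refine step _ (fun t => 2 * v ^ 2 * t) fun t => ?_
    have h := (hasDerivAt_id t).const_mul v
    convert! (h.mul h).add_const v using 1
    simp; ring
  have d4 : iteratedDeriv 4 (fun t : ℝ => Real.exp (v * t ^ 2 / 2)) =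
      fun t => Real.exp (v * t ^ 2 / 2) * (v * t * (v * t * (v * t * (v * t) + v) + 2 * v ^ 2 * t)
        + (3 * v ^ 3 * t ^ 2 + 3 * v ^ 2)) := by
    rw [iteratedDeriv_succ, d3]
    refine step _ (fun t => 3 * v ^ 3 * t ^ 2 + 3 * v ^ 2) fun t => ?_
    have h := (hasDerivAt_id t).const_mul v
    convert! (h.mul ((h.mul h).add_const v)).add ((hasDerivAt_id t).const_mul (2 * v ^ 2)) using 1
    simp; ring
  refine ⟨?_, ?_, ?_, ?_⟩
  · simp [d1]
  · simp [d2]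
  · simp [d3]
  · simp [d4]

lemma integral_pow_gaussianReal (v : NNReal) :
    ∫ r, r ∂(gaussianReal 0 v) = 0 ∧ ∫ r, r ^ 2 ∂(gaussianReal 0 v) = v ∧
    ∫ r, r ^ 3 ∂(gaussianReal 0 v) = 0 ∧ ∫ r, r ^ 4 ∂(gaussianReal 0 v) = 3 * (v : ℝ) ^ 2 := by
  have hmgf : mgf id (gaussianReal 0 v) = fun t => Real.exp (v * t ^ 2 / 2) := by
    ext t
    rw [mgf_gaussianReal (μ := 0) (v := v) (by simp)]
    simp
  have h0 : (0 : ℝ) ∈ interior (integrableExpSet id (gaussianReal 0 v)) := by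
    simp [integrableExpSet_id_gaussianReal]
  have key := fun k => iteratedDeriv_mgf_zero h0 k
  rw [hmgf] at key
  obtain ⟨h1, h2, h3, h4⟩ := iteratedDeriv_exp_sq v
  refine ⟨?_, ?_, ?_, ?_⟩
  · simp
  · simpa using (key 2).symm.trans h2
  · simpa using (key 3).symm.trans h3
  · simpa using (key 4).symm.trans h4

/-! ### The mixture law -/

section mixture

variable (α₁ : unitInterval) (μ₁ μ₂ : Vec p) (S : Matrix (Fin p) (Fin p) ℝ)

lemma xLaw_eq : xLaw α₁ μ₁ μ₂ S =
    unitInterval.toNNReal α₁ • multivariateGaussian μ₁ S +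
      unitInterval.toNNReal (unitInterval.symm α₁) • multivariateGaussian μ₂ S := by
  have : IsMarkovKernel (Kernel.ofFunOfCountable
      (fun y : ℕ => multivariateGaussian ((y : ℝ) • μ₁ + (1 - (y : ℝ)) • μ₂) S)) :=
    ⟨fun y => by
      change IsProbabilityMeasure (multivariateGaussian _ S)
      infer_instance⟩
  rw [xLaw, pairLaw, Measure.snd_compProd]
  ext s hs
  rw [Measure.bind_apply hs (Kernel.aemeasurable _), bernoulliMeasure_def, lintegral_add_measure,
    lintegral_smul_measure, lintegral_smul_measure, lintegral_dirac, lintegral_dirac]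
  simp [Kernel.ofFunOfCountable]

lemma multivariateGaussian_eq_map (μ : Vec p) :
    multivariateGaussian μ S = (multivariateGaussian 0 S).map (fun x => μ + x) := by
  rw [multivariateGaussian, multivariateGaussian, Measure.map_map (by fun_prop) (by fun_prop)]
  congr 1
  ext1 x
  simp

/-- The mean of the mixture. -/
noncomputable def mixMean (α₁ : ℝ) (μ₁ μ₂ : Vec p) : Vec p := α₁ • μ₁ + (1 - α₁) • μ₂

variable {F : Type*} [NormedAddCommGroup F]

variable {α₁ μ₁ μ₂ S} in
lemma integrable_xLaw {f : Vec p → F} (hf : PolyGrowth f) : Integrable f (xLaw α₁ μ₁ μ₂ S) := by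
  rw [xLaw_eq]
  exact ((hf.integrable _).smul_measure_nnreal).add_measure ((hf.integrable _).smul_measure_nnreal)

variable {α₁ μ₁ μ₂ S} in
-- Seen from the mixture mean, the component centres are multiples of `μ₂ - μ₁`, so all moments
-- reduce to those of one centred Gaussian.
lemma integral_xLaw [NormedSpace ℝ F] {f : Vec p → F} (hf : PolyGrowth f) :
    ∫ x, f (x - mixMean α₁ μ₁ μ₂) ∂(xLaw α₁ μ₁ μ₂ S) =
      (α₁ : ℝ) • ∫ x, f (-(1 - α₁ : ℝ) • (μ₂ - μ₁) + x) ∂(multivariateGaussian 0 S) +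
      (1 - α₁ : ℝ) • ∫ x, f ((α₁ : ℝ) • (μ₂ - μ₁) + x) ∂(multivariateGaussian 0 S) := by
  have hf' : PolyGrowth (fun x => f (x - mixMean α₁ μ₁ μ₂)) := by
    simpa [sub_eq_neg_add] using hf.comp_add (-(mixMean α₁ μ₁ μ₂))
  have hc := hf'.1
  rw [xLaw_eq, integral_add_measure ((hf'.integrable _).smul_measure_nnreal)
    ((hf'.integrable _).smul_measure_nnreal), integral_smul_nnreal_measure,
    integral_smul_nnreal_measure, multivariateGaussian_eq_map S μ₁,
    multivariateGaussian_eq_map S μ₂,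
    integral_map (by fun_prop) hc.aestronglyMeasurable,
    integral_map (by fun_prop) hc.aestronglyMeasurable]
  congr 1
  · rw [NNReal.smul_def]
    congr 2
    ext1 x
    congr 1
    simp only [mixMean]
    module
  · rw [NNReal.smul_def]
    congr 2
    ext1 x
    congr 1
    simp only [mixMean]
    module

end mixture

/-! ### Moments of the centered Gaussian law -/

section gaussian

variable {S : Matrix (Fin p) (Fin p) ℝ}

/-- The covariance operator. -/
noncomputable def covOp (S : Matrix (Fin p) (Fin p) ℝ) : Vec p →L[ℝ] Vec p :=
  Matrix.toEuclideanCLM (𝕜 := ℝ) S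

lemma inner_covOp (y z : Vec p) : inner ℝ y (covOp S z) = y.ofLp ⬝ᵥ S *ᵥ z.ofLp :=
  Matrix.inner_toEuclideanCLM S y z

lemma integral_inner_gaussian (y : Vec p) :
    ∫ x, inner ℝ y x ∂(multivariateGaussian 0 S) = 0 := by
  rw [integral_inner IsGaussian.integrable_fun_id]
  simp

lemma cov_gaussian (hS : S.PosSemidef) (y z : Vec p) :
    cov[fun x => inner ℝ y x, fun x => inner ℝ z x; multivariateGaussian 0 S] =
      inner ℝ y (covOp S z) := by
  rw [← covarianceBilin_apply_eq_cov IsGaussian.memLp_two_id,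
    covarianceBilin_multivariateGaussian hS, inner_covOp]

lemma integral_inner_mul_inner_gaussian (hS : S.PosSemidef) (y z : Vec p) :
    ∫ x, inner ℝ y x * inner ℝ z x ∂(multivariateGaussian 0 S) = inner ℝ y (covOp S z) := by
  rw [← cov_gaussian hS, covariance]
  simp [integral_inner_gaussian]

lemma map_neg_gaussian (hS : S.PosSemidef) : (multivariateGaussian (0 : Vec p) S).map (fun x => -x) =
    multivariateGaussian 0 S := by
  refine Measure.ext_of_charFun (funext fun t => ?_)
  have h : charFun ((multivariateGaussian (0 : Vec p) S).map (fun x => -x)) t =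
      charFun (multivariateGaussian (0 : Vec p) S) (-t) := by
    rw [charFun_apply, charFun_apply, integral_map (by fun_prop) (by fun_prop)]
    simp
  rw [h, charFun_multivariateGaussian hS, charFun_multivariateGaussian hS]
  simp [Matrix.mulVec_neg]

lemma integral_odd_gaussian (hS : S.PosSemidef) {f : Vec p → ℝ} (hf : Continuous f) (hodd : ∀ x, f (-x) = -f x) :
    ∫ x, f x ∂(multivariateGaussian 0 S) = 0 := by
  have h : ∫ x, f x ∂(multivariateGaussian 0 S) = -∫ x, f x ∂(multivariateGaussian 0 S) := by
    conv_lhs => rw [← map_neg_gaussian hS, integral_map (by fun_prop) hf.aestronglyMeasurable]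
    simp [hodd, integral_neg]
  linarith

lemma map_inner_gaussian (hS : S.PosSemidef) (y : Vec p) :
    (multivariateGaussian 0 S).map (fun x => inner ℝ y x) =
      gaussianReal 0 (inner ℝ y (covOp S y)).toNNReal := by
  have := IsGaussian.map_eq_gaussianReal (μ := multivariateGaussian 0 S) (innerSL ℝ y)
  simp only [innerSL_apply_apply] at this
  change (multivariateGaussian 0 S).map (fun x => inner ℝ y x) = _ at this
  rw [this, integral_inner_gaussian, ← covariance_self (by fun_prop)]
  congr 2
  exact cov_gaussian hS y y

/-- Jointly Gaussian and uncorrelated implies independent. -/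
lemma indepFun_gaussian (hS : S.PosSemidef) {y z : Vec p} (h : inner ℝ y (covOp S z) = 0) :
    IndepFun (fun x => inner ℝ y x) (fun x => inner ℝ z x) (multivariateGaussian 0 S) := by
  refine HasGaussianLaw.indepFun_of_covariance_eq_zero ?_ (by rw [cov_gaussian hS, h])
  exact IsGaussian.hasGaussianLaw_id.map ((innerSL ℝ y).prod (innerSL ℝ z))

/-- `f` is integrable with integral `a`. -/
structure HasInt (ν : Measure (Vec p)) (f : Vec p → ℝ) (a : ℝ) : Prop where
  integrable : Integrable f ν
  integral_eq : ∫ x, f x ∂ν = a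

namespace HasInt

variable {ν : Measure (Vec p)} {f g : Vec p → ℝ} {a b : ℝ}

lemma add (hf : HasInt ν f a) (hg : HasInt ν g b) : HasInt ν (fun x => f x + g x) (a + b) :=
  ⟨hf.1.add hg.1, by rw [integral_add hf.1 hg.1, hf.2, hg.2]⟩

lemma const_mul (hf : HasInt ν f a) (c : ℝ) : HasInt ν (fun x => c * f x) (c * a) :=
  ⟨hf.1.const_mul c, by rw [integral_const_mul, hf.2]⟩

lemma const [IsProbabilityMeasure ν] (c : ℝ) : HasInt ν (fun _ => c) c :=
  ⟨integrable_const c, by simp⟩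

end HasInt

lemma hasInt_inner (y : Vec p) : HasInt (multivariateGaussian 0 S) (fun x => inner ℝ y x) 0 :=
  ⟨(PolyGrowth.inner_const y).integrable _, integral_inner_gaussian y⟩

lemma hasInt_inner_mul (hS : S.PosSemidef) (y z : Vec p) : HasInt (multivariateGaussian 0 S)
    (fun x => inner ℝ y x * inner ℝ z x) (inner ℝ y (covOp S z)) :=
  ⟨((PolyGrowth.inner_const y).mul (PolyGrowth.inner_const z)).integrable _,
    integral_inner_mul_inner_gaussian hS y z⟩

lemma integral_shift_mul_shift (hS : S.PosSemidef) (y z : Vec p) (s t : ℝ) :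
    ∫ x, (s + inner ℝ y x) * (t + inner ℝ z x) ∂(multivariateGaussian 0 S) =
      s * t + inner ℝ y (covOp S z) := by
  have h := (((HasInt.const (ν := multivariateGaussian 0 S) (s * t)).add
    ((hasInt_inner y).const_mul t)).add ((hasInt_inner z).const_mul s)).add (hasInt_inner_mul hS y z)
  rw [show s * t + inner ℝ y (covOp S z) = s * t + t * 0 + s * 0 + inner ℝ y (covOp S z) by ring,
    ← h.2]
  congr 1
  ext1 x
  ring

lemma integral_shift_mul_shift_mul_shift (hS : S.PosSemidef) (y z w : Vec p) (s t r : ℝ) :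
    ∫ x, (s + inner ℝ y x) * (t + inner ℝ z x) * (r + inner ℝ w x) ∂(multivariateGaussian 0 S) =
      s * t * r + r * inner ℝ y (covOp S z) + t * inner ℝ y (covOp S w) +
        s * inner ℝ z (covOp S w) := by
  have h3 : HasInt (multivariateGaussian 0 S)
      (fun x => inner ℝ y x * inner ℝ z x * inner ℝ w x) 0 :=
    ⟨(((PolyGrowth.inner_const y).mul (PolyGrowth.inner_const z)).mul
      (PolyGrowth.inner_const w)).integrable _,
      integral_odd_gaussian hS (by fun_prop) (fun x => by simp only [inner_neg_right]; ring)⟩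
  have h := ((((((HasInt.const (ν := multivariateGaussian 0 S) (s * t * r)).add
    ((hasInt_inner y).const_mul (t * r))).add ((hasInt_inner z).const_mul (s * r))).add
    ((hasInt_inner w).const_mul (s * t))).add ((hasInt_inner_mul hS y z).const_mul r)).add
    ((hasInt_inner_mul hS y w).const_mul t)).add ((hasInt_inner_mul hS z w).const_mul s) |>.add h3
  rw [show s * t * r + r * inner ℝ y (covOp S z) + t * inner ℝ y (covOp S w) +
      s * inner ℝ z (covOp S w) = s * t * r + t * r * 0 + s * r * 0 + s * t * 0 +
        r * inner ℝ y (covOp S z) + t * inner ℝ y (covOp S w) + s * inner ℝ z (covOp S w) + 0 by ring,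
    ← h.2]
  congr 1
  ext1 x
  ring

lemma integral_quad_sq (hS : S.PosSemidef) (y : Vec p) (s k₀ k₁ k₂ : ℝ) :
    ∫ x, (k₂ * (s + inner ℝ y x) ^ 2 + k₁ * (s + inner ℝ y x) + k₀) ^ 2
        ∂(multivariateGaussian 0 S) =
      (k₂ * s ^ 2 + k₁ * s + k₀) ^ 2 + ((2 * k₂ * s + k₁) ^ 2 + 2 * (k₂ * s ^ 2 + k₁ * s + k₀) * k₂)
        * inner ℝ y (covOp S y) + 3 * k₂ ^ 2 * inner ℝ y (covOp S y) ^ 2 := by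
  set v := inner ℝ y (covOp S y) with hv
  have hv0 : 0 ≤ v := by
    rw [hv, ← integral_inner_mul_inner_gaussian hS]
    exact integral_nonneg fun x => mul_self_nonneg _
  have hpow : ∀ k : ℕ, ∀ a : ℝ, ∫ r, r ^ k ∂(gaussianReal 0 v.toNNReal) = a →
      HasInt (multivariateGaussian 0 S) (fun x => inner ℝ y x ^ k) a := fun k a ha => by
    refine ⟨((PolyGrowth.inner_const y).pow k).integrable _, ?_⟩
    rw [← ha, ← map_inner_gaussian hS, integral_map (by fun_prop) (by fun_prop)]
  obtain ⟨-, m2, m3, m4⟩ := integral_pow_gaussianReal v.toNNReal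
  rw [Real.coe_toNNReal _ hv0] at m2 m4
  -- Value and slope of the quadratic at `s`: with `r` the Gaussian variable, the integrand is `(b +
  -- d r + k₂ r²)²`, and only even powers of `r` contribute.
  set b := k₂ * s ^ 2 + k₁ * s + k₀ with hb
  set d := 2 * k₂ * s + k₁ with hd
  have h := ((((HasInt.const (ν := multivariateGaussian 0 S) (b ^ 2)).add
    ((hasInt_inner y).const_mul (2 * b * d))).add ((hpow 2 _ m2).const_mul (d ^ 2 + 2 * b * k₂))).add
    ((hpow 3 _ m3).const_mul (2 * d * k₂))).add ((hpow 4 _ m4).const_mul (k₂ ^ 2))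
  rw [show b ^ 2 + (d ^ 2 + 2 * b * k₂) * v + 3 * k₂ ^ 2 * v ^ 2 = b ^ 2 + 2 * b * d * 0 +
    (d ^ 2 + 2 * b * k₂) * v + 2 * d * k₂ * 0 + k₂ ^ 2 * (3 * v ^ 2) by ring, ← h.2]
  congr 1
  ext1 x
  rw [hb, hd]
  ring

lemma integral_comp_mul_of_inner_eq_zero (hS : S.PosSemidef) {y z : Vec p}
    (h : inner ℝ y (covOp S z) = 0) {f g : ℝ → ℝ} (hf : Continuous f) (hg : Continuous g) :
    ∫ x, f (inner ℝ y x) * g (inner ℝ z x) ∂(multivariateGaussian 0 S) =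
      (∫ x, f (inner ℝ y x) ∂(multivariateGaussian 0 S)) *
        ∫ x, g (inner ℝ z x) ∂(multivariateGaussian 0 S) :=
  (indepFun_gaussian hS h).integral_fun_comp_mul_comp (by fun_prop) (by fun_prop)
    hf.aestronglyMeasurable hg.aestronglyMeasurable

end gaussian

/-! ### The population model -/

lemma covOp_mul (S T : Matrix (Fin p) (Fin p) ℝ) (y : Vec p) :
    covOp S (covOp T y) = covOp (S * T) y := by
  simp [covOp]

lemma covOp_one (y : Vec p) : covOp (1 : Matrix (Fin p) (Fin p) ℝ) y = y := by
  simp [covOp]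

lemma covOp_symm {S : Matrix (Fin p) (Fin p) ℝ} (hS : S.IsHermitian) (y z : Vec p) :
    inner ℝ (covOp S y) z = inner ℝ y (covOp S z) := by
  rw [real_inner_comm, inner_covOp, inner_covOp, dotProduct_comm z.ofLp, Matrix.dotProduct_mulVec,
    ← Matrix.mulVec_transpose, show Sᵀ = S by simpa using hS.eq, dotProduct_comm]

lemma popModel {S : Matrix (Fin p) (Fin p) ℝ} (hS : S.PosDef) {h : Vec p} (hh : h ≠ 0) :
    PopModel (covOp S) (covOp S⁻¹) h where
  symm := covOp_symm hS.1
  pos y hy := by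
    rw [covOp_symm hS.1, inner_covOp]
    have := hS.dotProduct_mulVec_pos (x := y.ofLp) (by simpa using hy)
    simpa using this
  right_inv y := by
    rw [covOp_mul, Matrix.mul_nonsing_inv _ ((Matrix.isUnit_iff_isUnit_det _).1 hS.isUnit), covOp_one]
  left_inv y := by
    rw [covOp_mul, Matrix.nonsing_inv_mul _ ((Matrix.isUnit_iff_isUnit_det _).1 hS.isUnit), covOp_one]
  ne_zero := hh

section population

variable {α₁ : unitInterval} {μ₁ μ₂ : Vec p} {S : Matrix (Fin p) (Fin p) ℝ}

lemma PolyGrowth.comp_sub {F : Type*} [NormedAddCommGroup F] {f : Vec p → F} (hf : PolyGrowth f)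
    (m : Vec p) : PolyGrowth (fun x => f (x - m)) := by
  simpa [sub_eq_neg_add] using hf.comp_add (-m)

lemma polyGrowth_id : PolyGrowth (fun x : Vec p => x) :=
  PolyGrowth.clm (ContinuousLinearMap.id ℝ (Vec p))

lemma polyGrowth_outer : PolyGrowth (fun x : Vec p => outer p x x) :=
  polyGrowth_id.bilin (outer p) polyGrowth_id

lemma polyGrowth_outerCube : PolyGrowth (outerCube (p := p)) := by
  refine ⟨continuous_outerCube, 3, 1, zero_le_one, fun x => ?_⟩
  have h : ‖outerCube x‖ ≤ ‖x‖ ^ 3 := by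
    refine ContinuousLinearMap.opNorm_le_bound₂ _ (by positivity) fun y z => ?_
    rw [outerCube_apply, norm_smul, norm_smul]
    calc _ ≤ (‖x‖ * ‖y‖) * ((‖x‖ * ‖z‖) * ‖x‖) := by
          gcongr <;> exact norm_inner_le_norm _ _
      _ = ‖x‖ ^ 3 * ‖y‖ * ‖z‖ := by ring
  rw [one_mul]
  exact h.trans (by gcongr; simp)

/-- The third central moment of the mixing variable. -/
noncomputable def mixThird (a : ℝ) : ℝ := mixBeta a * (2 * a - 1)

lemma integral_sub_mixMean :
    ∫ x, (x - mixMean α₁ μ₁ μ₂) ∂(xLaw α₁ μ₁ μ₂ S) = 0 := by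
  have h_integrable := integrable_xLaw (α₁ := α₁) (μ₁ := μ₁) (μ₂ := μ₂) (S := S)
    (polyGrowth_id.comp_sub (mixMean α₁ μ₁ μ₂))
  refine ext_inner_left ℝ fun z => ?_
  rw [← integral_inner h_integrable, integral_xLaw (PolyGrowth.inner_const z)]
  simp only [inner_add_right]
  rw [((HasInt.const _).add (hasInt_inner z)).2, ((HasInt.const _).add (hasInt_inner z)).2]
  simp only [real_inner_smul_right, smul_eq_mul, inner_zero_right]
  ring

lemma integral_outer (hS : S.PosSemidef) :
    ∫ x, outer p (x - mixMean α₁ μ₁ μ₂) (x - mixMean α₁ μ₁ μ₂) ∂(xLaw α₁ μ₁ μ₂ S) =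
      popSecond (covOp S) (μ₂ - μ₁) (mixBeta α₁) := by
  have h_integrable := integrable_xLaw (α₁ := α₁) (μ₁ := μ₁) (μ₂ := μ₂) (S := S)
    (polyGrowth_outer.comp_sub (mixMean α₁ μ₁ μ₂))
  ext1 y
  rw [ContinuousLinearMap.integral_apply h_integrable, popSecond_apply]
  refine ext_inner_left ℝ fun z => ?_
  rw [← integral_inner (h_integrable.apply_continuousLinearMap y)]
  have e : ∀ x : Vec p, inner ℝ z (outer p (x - mixMean α₁ μ₁ μ₂) (x - mixMean α₁ μ₁ μ₂) y) =
      inner ℝ y (x - mixMean α₁ μ₁ μ₂) * inner ℝ z (x - mixMean α₁ μ₁ μ₂) := fun x => by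
    rw [outer_apply, real_inner_smul_right, real_inner_comm]
  simp only [e]
  rw [integral_xLaw ((PolyGrowth.inner_const y).mul (PolyGrowth.inner_const z))]
  simp only [inner_add_right, integral_shift_mul_shift hS]
  have hsym : inner ℝ y (covOp S z) = inner ℝ z (covOp S y) := by
    rw [← covOp_symm hS.1, real_inner_comm]
  simp only [hsym, real_inner_smul_right, smul_eq_mul, mixBeta, real_inner_comm y]
  ring

/-- Gaussian third moments vanish by symmetry, and covariance terms cancel because the centred
component means average to `0`. What remains is `a³ (1 - a) - (1 - a)³ a`, with `a = α₁`. -/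
lemma integral_outerCube (hS : S.PosSemidef) :
    ∫ x, outerCube (x - mixMean α₁ μ₁ μ₂) ∂(xLaw α₁ μ₁ μ₂ S) =
      popThird (μ₂ - μ₁) (mixThird α₁) := by
  have h_integrable := integrable_xLaw (α₁ := α₁) (μ₁ := μ₁) (μ₂ := μ₂) (S := S)
    (polyGrowth_outerCube.comp_sub (mixMean α₁ μ₁ μ₂))
  ext1 y
  rw [ContinuousLinearMap.integral_apply h_integrable]
  ext1 w
  rw [ContinuousLinearMap.integral_apply (h_integrable.apply_continuousLinearMap y), popThird_apply]
  refine ext_inner_left ℝ fun z => ?_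
  rw [← integral_inner ((h_integrable.apply_continuousLinearMap y).apply_continuousLinearMap w)]
  have e : ∀ x : Vec p, inner ℝ z (outerCube (x - mixMean α₁ μ₁ μ₂) y w) =
      inner ℝ y (x - mixMean α₁ μ₁ μ₂) * inner ℝ w (x - mixMean α₁ μ₁ μ₂) *
        inner ℝ z (x - mixMean α₁ μ₁ μ₂) := fun x => by
    rw [outerCube_apply, real_inner_smul_right, real_inner_smul_right, real_inner_comm,
      real_inner_comm w, mul_assoc]
  simp only [e]
  rw [integral_xLaw (((PolyGrowth.inner_const y).mul (PolyGrowth.inner_const w)).mul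
    (PolyGrowth.inner_const z))]
  simp only [inner_add_right, integral_shift_mul_shift_mul_shift hS]
  simp only [real_inner_smul_right, smul_eq_mul, mixThird, mixBeta, real_inner_comm y,
    real_inner_comm w]
  ring

/-- Mixing usually destroys independence. Here `z` is orthogonal to `μ₂ - μ₁`, so the second factor
has the same law in both components and can be pulled out. -/
lemma integral_comp_inner_mul_comp_inner (hS : S.PosSemidef) {u z : Vec p}
    (horth : inner ℝ u (covOp S z) = 0) (hz : inner ℝ z (μ₂ - μ₁) = 0) {f g : ℝ → ℝ}
    (hf : PolyGrowth (fun x => f (inner ℝ u x))) (hg : PolyGrowth (fun x => g (inner ℝ z x)))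
    (hfc : Continuous f) (hgc : Continuous g) :
    ∫ x, f (inner ℝ u (x - mixMean α₁ μ₁ μ₂)) * g (inner ℝ z (x - mixMean α₁ μ₁ μ₂))
        ∂(xLaw α₁ μ₁ μ₂ S) =
      (∫ x, f (inner ℝ u (x - mixMean α₁ μ₁ μ₂)) ∂(xLaw α₁ μ₁ μ₂ S)) *
        ∫ x, g (inner ℝ z x) ∂(multivariateGaussian 0 S) := by
  rw [integral_xLaw (hf.mul hg), integral_xLaw hf]
  simp only [inner_add_right, real_inner_smul_right, hz, mul_zero, zero_add]
  have h := fun s : ℝ => integral_comp_mul_of_inner_eq_zero hS horth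
    (f := fun r => f (s + r)) (by fun_prop) hgc
  rw [h, h]
  simp only [smul_eq_mul]
  ring

end population

/-! ### Limit theorems for the sample -/

section sample

variable {Ω : Type*} [MeasurableSpace Ω] {P : Measure Ω}
  {α₁ : unitInterval} {μ₁ μ₂ : Vec p} {S : Matrix (Fin p) (Fin p) ℝ} {X : ℕ → Ω → Vec p}

lemma identDistrib_comp (hX : ∀ i, HasLaw (X i) (xLaw α₁ μ₁ μ₂ S) P) {F : Type*}
    [MeasurableSpace F] {f : Vec p → F} (hf : Measurable f) (i : ℕ) :
    IdentDistrib (fun ω => f (X i ω)) (fun ω => f (X 0 ω)) P P :=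
  IdentDistrib.comp ⟨(hX i).aemeasurable, (hX 0).aemeasurable,
    (hX i).map_eq.trans (hX 0).map_eq.symm⟩ hf

lemma integral_comp_sample (hX : ∀ i, HasLaw (X i) (xLaw α₁ μ₁ μ₂ S) P) {F : Type*}
    [NormedAddCommGroup F] [NormedSpace ℝ F] {f : Vec p → F} (hf : Continuous f)
    [SecondCountableTopology F] :
    ∫ ω, f (X 0 ω) ∂P = ∫ x, f x ∂(xLaw α₁ μ₁ μ₂ S) := by
  rw [← (hX 0).map_eq, integral_map (hX 0).aemeasurable hf.aestronglyMeasurable]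

lemma integrable_comp_sample (hX : ∀ i, HasLaw (X i) (xLaw α₁ μ₁ μ₂ S) P) {F : Type*}
    [NormedAddCommGroup F] [NormedSpace ℝ F] {f : Vec p → F} (hf : PolyGrowth f) :
    Integrable (fun ω => f (X 0 ω)) P := by
  have h := integrable_xLaw (α₁ := α₁) (μ₁ := μ₁) (μ₂ := μ₂) (S := S) hf
  rw [← (hX 0).map_eq] at h
  exact h.comp_aemeasurable (hX 0).aemeasurable

lemma ae_tendsto_avg (hX : ∀ i, HasLaw (X i) (xLaw α₁ μ₁ μ₂ S) P) (hindep : iIndepFun X P)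
    {F : Type*} [NormedAddCommGroup F] [NormedSpace ℝ F] [CompleteSpace F]
    [SecondCountableTopology F] [MeasurableSpace F] [BorelSpace F] {f : Vec p → F}
    (hf : PolyGrowth f) :
    ∀ᵐ ω ∂P, Tendsto (fun n => avg n (fun i => f (X i ω))) atTop
      (𝓝 (∫ x, f x ∂(xLaw α₁ μ₁ μ₂ S))) := by
  rw [← integral_comp_sample hX hf.1]
  exact strong_law_ae (fun i ω => f (X i ω)) (integrable_comp_sample hX hf)
    (fun i j hij => (hindep.indepFun hij).comp hf.1.measurable hf.1.measurable)
    (identDistrib_comp hX hf.1.measurable)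

lemma ae_momentsConverge (hX : ∀ i, HasLaw (X i) (xLaw α₁ μ₁ μ₂ S) P) (hindep : iIndepFun X P)
    (hS : S.PosSemidef) :
    ∀ᵐ ω ∂P, MomentsConverge (fun i => X i ω) (mixMean α₁ μ₁ μ₂)
      (popSecond (covOp S) (μ₂ - μ₁) (mixBeta α₁)) (popThird (μ₂ - μ₁) (mixThird α₁)) := by
  have h1 := ae_tendsto_avg hX hindep (polyGrowth_id.comp_sub (mixMean α₁ μ₁ μ₂))
  have h2 := ae_tendsto_avg hX hindep (polyGrowth_outer.comp_sub (mixMean α₁ μ₁ μ₂))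
  have h3 := ae_tendsto_avg hX hindep (polyGrowth_outerCube.comp_sub (mixMean α₁ μ₁ μ₂))
  rw [integral_sub_mixMean] at h1
  rw [integral_outer hS] at h2
  rw [integral_outerCube hS] at h3
  filter_upwards [h1, h2, h3] with ω a b c using ⟨a, b, c⟩

/-- The central limit theorem for `g(⟪u, x - m⟫) (x - m)`, with `g` quadratic, projected on the
subspace where it is independent of `⟪u, x - m⟫`. -/
lemma tendstoInDistribution_quad [IsProbabilityMeasure P]
    (hX : ∀ i, HasLaw (X i) (xLaw α₁ μ₁ μ₂ S) P)
    (hindep : iIndepFun X P) (hS : S.PosSemidef) {u : Vec p} {Γ : Vec p →L[ℝ] Vec p}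
    (hΓ : Γ (μ₂ - μ₁) = 0) (horth : ∀ t, inner ℝ u (covOp S (Γ.adjoint t)) = 0)
    {T : Matrix (Fin p) (Fin p) ℝ} (hT : T.PosSemidef)
    (hTΓ : ∀ t : Vec p, inner ℝ (Γ.adjoint t) (covOp S (Γ.adjoint t)) = t.ofLp ⬝ᵥ T *ᵥ t.ofLp)
    (k₀ k₁ k₂ : ℝ) :
    TendstoInDistribution (fun (n : ℕ) ω => (√(n : ℝ))⁻¹ • ∑ i ∈ Finset.range n,
      (k₂ * inner ℝ u (X i ω - mixMean α₁ μ₁ μ₂) ^ 2 + k₁ * inner ℝ u (X i ω - mixMean α₁ μ₁ μ₂)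
        + k₀) • Γ (X i ω - mixMean α₁ μ₁ μ₂)) atTop id (fun _ => P)
      (multivariateGaussian 0
        ((∫ x, (k₂ * inner ℝ u (x - mixMean α₁ μ₁ μ₂) ^ 2 + k₁ * inner ℝ u (x - mixMean α₁ μ₁ μ₂)
          + k₀) ^ 2 ∂(xLaw α₁ μ₁ μ₂ S)) • T)) := by
  set m := mixMean α₁ μ₁ μ₂ with hm
  have hquad : PolyGrowth (fun x : Vec p => k₂ * inner ℝ u x ^ 2 + k₁ * inner ℝ u x + k₀) :=
    (((PolyGrowth.const k₂).mul ((PolyGrowth.inner_const u).pow 2)).add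
      ((PolyGrowth.const k₁).mul (PolyGrowth.inner_const u))).add (PolyGrowth.const k₀)
  have hf : PolyGrowth (fun x : Vec p => (k₂ * inner ℝ u (x - m) ^ 2 + k₁ * inner ℝ u (x - m) + k₀) •
      Γ (x - m)) := (hquad.smul (PolyGrowth.clm Γ)).comp_sub m
  have hz : ∀ t, inner ℝ (Γ.adjoint t) (μ₂ - μ₁) = 0 := fun t => by
    rw [ContinuousLinearMap.adjoint_inner_left, hΓ, inner_zero_right]
  have hinner : ∀ t x : Vec p, inner ℝ t ((k₂ * inner ℝ u (x - m) ^ 2 + k₁ * inner ℝ u (x - m) + k₀) •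
      Γ (x - m)) = (k₂ * inner ℝ u (x - m) ^ 2 + k₁ * inner ℝ u (x - m) + k₀) *
        inner ℝ (Γ.adjoint t) (x - m) := fun t x => by
    rw [real_inner_smul_right, ContinuousLinearMap.adjoint_inner_left]
  refine tendstoInDistribution_multivariateGaussian (hindep.comp _ fun _ => hf.1.measurable)
    (identDistrib_comp hX hf.1.measurable) ?_ (hT.smul ?_) (fun t => ?_) (fun t => ?_)
  · rw [memLp_two_iff_integrable_sq_norm
      (hf.1.measurable.comp_aemeasurable (hX 0).aemeasurable).aestronglyMeasurable]
    exact integrable_comp_sample hX hf.norm_sq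
  · exact integral_nonneg fun x => sq_nonneg _
  · have hc := hf.1
    refine (integral_comp_sample hX (f := fun x => inner ℝ t ((k₂ * inner ℝ u (x - m) ^ 2 +
      k₁ * inner ℝ u (x - m) + k₀) • Γ (x - m))) (by fun_prop)).trans ?_
    simp only [hinner]
    -- The second factor has mean `0`, so the summands are centred for every quadratic.
    have := integral_comp_inner_mul_comp_inner (α₁ := α₁) hS (horth t) (hz t)
      (f := fun r => k₂ * r ^ 2 + k₁ * r + k₀) (g := fun r => r) hquad (PolyGrowth.inner_const _)
      (by fun_prop) (by fun_prop)
    rw [this, integral_inner_gaussian, mul_zero]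
  · have hc := hf.1
    refine (integral_comp_sample hX (f := fun x => inner ℝ t ((k₂ * inner ℝ u (x - m) ^ 2 +
      k₁ * inner ℝ u (x - m) + k₀) • Γ (x - m)) ^ 2) (by fun_prop)).trans ?_
    simp only [hinner, mul_pow]
    have := integral_comp_inner_mul_comp_inner (α₁ := α₁) hS (horth t) (hz t)
      (f := fun r => (k₂ * r ^ 2 + k₁ * r + k₀) ^ 2) (g := fun r => r ^ 2) (hquad.pow 2)
      ((PolyGrowth.inner_const _).pow 2) (by fun_prop) (by fun_prop)
    rw [this]
    simp only [pow_two (inner ℝ (Γ.adjoint t) _)]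
    rw [integral_inner_mul_inner_gaussian hS, hTΓ, Matrix.smul_mulVec, dotProduct_smul, smul_eq_mul]

end sample


/-! ### The limiting covariance matrix -/

lemma discriminant_eq (μ₁ μ₂ : Vec p) (S : Matrix (Fin p) (Fin p) ℝ) :
    discriminant μ₁ μ₂ S = covOp S⁻¹ (μ₂ - μ₁) := rfl

lemma unitDiscriminant_eq (μ₁ μ₂ : Vec p) (S : Matrix (Fin p) (Fin p) ℝ) :
    unitDiscriminant μ₁ μ₂ S = unitDir (covOp S⁻¹) (μ₂ - μ₁) := rfl

lemma mahalanobisSq_eq (μ₁ μ₂ : Vec p) (S : Matrix (Fin p) (Fin p) ℝ) :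
    mahalanobisSq μ₁ μ₂ S = inner ℝ (μ₂ - μ₁) (covOp S⁻¹ (μ₂ - μ₁)) := by
  rw [inner_covOp, mahalanobisSq]

lemma covOp_orthProj (θ y : Vec p) :
    covOp (orthProj θ) y = projAlong (‖θ‖⁻¹ • θ) y := by
  have h : Matrix.vecMulVec θ.ofLp θ.ofLp *ᵥ y.ofLp = inner ℝ θ y • θ.ofLp := by
    ext i
    simp [Matrix.vecMulVec_mulVec, PiLp.inner_apply, dotProduct, mul_comm]
  have h2 : covOp (orthProj θ) y = y - ((‖θ‖ ^ 2)⁻¹ * inner ℝ θ y) • θ := by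
    ext i
    simp [covOp, orthProj, h, mul_assoc]
  rw [h2, projAlong_apply, real_inner_smul_left, smul_smul]
  congr 2
  ring

lemma isHermitian_orthProj (θ : Vec p) : (orthProj θ).IsHermitian := by
  ext i j
  simp [orthProj, Matrix.vecMulVec, Matrix.one_apply, mul_comm, eq_comm]

/-- The covariance matrix of the score, up to a scalar. -/
noncomputable def scoreCov (θ : Vec p) (S : Matrix (Fin p) (Fin p) ℝ) : Matrix (Fin p) (Fin p) ℝ :=
  orthProj θ * S⁻¹ * orthProj θ

lemma posSemidef_scoreCov {S : Matrix (Fin p) (Fin p) ℝ} (hS : S.PosDef) (θ : Vec p) :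
    (scoreCov θ S).PosSemidef := by
  have := hS.inv.posSemidef.conjTranspose_mul_mul_same (orthProj θ)
  rwa [(isHermitian_orthProj θ).eq] at this

lemma inner_projAlong (u y z : Vec p) :
    inner ℝ (projAlong u y) z = inner ℝ y (projAlong u z) := by
  simp only [projAlong_apply, inner_sub_left, inner_sub_right, real_inner_smul_left,
    real_inner_smul_right, real_inner_comm u y]
  ring

/-- The operator sending an observation to its component independent of the discriminant score. -/
noncomputable def scoreOp (R : Vec p →L[ℝ] Vec p) (h : Vec p) : Vec p →L[ℝ] Vec p :=
  (projAlong (unitDir R h)).comp R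

section operator

variable {S : Matrix (Fin p) (Fin p) ℝ} {h : Vec p}

lemma adjoint_scoreOp (hS : S.PosDef) (t : Vec p) :
    (scoreOp (covOp S⁻¹) h).adjoint t = covOp S⁻¹ (projAlong (unitDir (covOp S⁻¹) h) t) := by
  refine ext_inner_right ℝ fun z => ?_
  rw [ContinuousLinearMap.adjoint_inner_left, covOp_symm hS.inv.1, inner_projAlong]
  rfl

/-- The adjoint is `R` after the projection, so applying `S` leaves a vector orthogonal to the
direction. Within each component the score operator's output is thus uncorrelated with the
discriminant score. -/
lemma inner_adjoint_scoreOp (hS : S.PosDef) (hh : h ≠ 0) (t : Vec p) :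
    inner ℝ (unitDir (covOp S⁻¹) h) (covOp S ((scoreOp (covOp S⁻¹) h).adjoint t)) = 0 := by
  have M := popModel hS hh
  rw [adjoint_scoreOp hS, M.right_inv, projAlong_apply, inner_sub_right, real_inner_smul_right,
    real_inner_self_eq_norm_sq, M.norm_unitDir]
  ring

lemma inner_adjoint_scoreOp_self (hS : S.PosDef) (hh : h ≠ 0) (t : Vec p) :
    inner ℝ ((scoreOp (covOp S⁻¹) h).adjoint t)
      (covOp S ((scoreOp (covOp S⁻¹) h).adjoint t)) =
      t.ofLp ⬝ᵥ scoreCov (covOp S⁻¹ h) S *ᵥ t.ofLp := by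
  have M := popModel hS hh
  rw [adjoint_scoreOp hS, M.right_inv, ← inner_covOp, scoreCov, ← covOp_mul, ← covOp_mul,
    covOp_orthProj, covOp_orthProj, ← inner_projAlong, real_inner_comm]
  rfl

end operator

section variance

variable {α₁ : unitInterval} {μ₁ μ₂ : Vec p} {S : Matrix (Fin p) (Fin p) ℝ}

/-- The quadratic `(b r² - c r - b²) / c` comes from `score_eq`, divided by `c`, on replacing the
random coefficients by their limits. Its second moment is the scalar factor of `PsiGamma`. -/
lemma integral_quad_xLaw (hS : S.PosDef) (hμ : μ₁ ≠ μ₂) (hα0 : (0 : ℝ) < α₁)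
    (hα1 : (α₁ : ℝ) < 1) (hα : (α₁ : ℝ) ≠ 1 / 2) {b c : ℝ}
    (hb : b = popVar (covOp S⁻¹) (μ₂ - μ₁) (mixBeta α₁))
    (hc : c = popSkew (covOp S⁻¹) (μ₂ - μ₁) (mixThird α₁)) :
    ∫ x, (c⁻¹ * b * inner ℝ (unitDir (covOp S⁻¹) (μ₂ - μ₁)) (x - mixMean α₁ μ₁ μ₂) ^ 2 +
      (-1) * inner ℝ (unitDir (covOp S⁻¹) (μ₂ - μ₁)) (x - mixMean α₁ μ₁ μ₂) +
      -(c⁻¹ * b ^ 2)) ^ 2 ∂(xLaw α₁ μ₁ μ₂ S) =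
    Cgamma (mixBeta α₁) (mahalanobisSq μ₁ μ₂ S) *
      ((1 + mixBeta α₁ * mahalanobisSq μ₁ μ₂ S) /
        (‖discriminant μ₁ μ₂ S‖ ^ 2 * mixBeta α₁)) := by
  have hh : μ₂ - μ₁ ≠ 0 := sub_ne_zero.2 hμ.symm
  have M := popModel hS hh
  have hτ := M.tau_pos
  have hN := M.norm_pos
  rw [mahalanobisSq_eq, discriminant_eq]
  set u := unitDir (covOp S⁻¹) (μ₂ - μ₁) with hu
  have hquad : PolyGrowth (fun x : Vec p => c⁻¹ * b * inner ℝ u x ^ 2 + (-1) * inner ℝ u x +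
      -(c⁻¹ * b ^ 2)) :=
    (((PolyGrowth.const _).mul ((PolyGrowth.inner_const u).pow 2)).add
      ((PolyGrowth.const _).mul (PolyGrowth.inner_const u))).add (PolyGrowth.const _)
  have huh : inner ℝ u (μ₂ - μ₁) = inner ℝ (μ₂ - μ₁) (covOp S⁻¹ (μ₂ - μ₁)) /
      ‖covOp S⁻¹ (μ₂ - μ₁)‖ := by
    rw [real_inner_comm]; exact M.inner_unitDir
  have huu : inner ℝ u (covOp S u) = inner ℝ (μ₂ - μ₁) (covOp S⁻¹ (μ₂ - μ₁)) /
      ‖covOp S⁻¹ (μ₂ - μ₁)‖ ^ 2 := by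
    rw [M.map_unitDir, real_inner_smul_right, huh]
    field_simp
  rw [integral_xLaw (hquad.pow 2)]
  simp only [inner_add_right, real_inner_smul_right, integral_quad_sq hS.posSemidef, huh, huu]
  rw [hb, hc]
  simp only [popVar, popSkew, mixThird, mixBeta, Cgamma, smul_eq_mul]
  generalize inner ℝ (μ₂ - μ₁) (covOp S⁻¹ (μ₂ - μ₁)) = τ at *
  generalize ‖covOp S⁻¹ (μ₂ - μ₁)‖ = N at *
  generalize (α₁ : ℝ) = a at *
  have ha1 : 1 - a ≠ 0 := by linarith
  have ha2 : 2 * a - 1 ≠ 0 := fun h => hα (by linarith)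
  -- The factor `1 - 4β` in `Cgamma` is the square of the factor in `mixThird`, nonzero since `a ≠
  -- 1/2`.
  have hd : 1 - 4 * (a * (1 - a)) = (2 * a - 1) ^ 2 := by ring
  rw [hd]
  generalize hda : 2 * a - 1 = d at ha2 ⊢
  field_simp
  rw [← hda]
  ring

end variance

/-! ### Asymptotic normality -/

section normality

variable {Ω : Type*} [MeasurableSpace Ω] {P : Measure Ω} {X : ℕ → Ω → Vec p}

lemma aemeasurable_sampleMoment (hX : ∀ i, AEMeasurable (X i) P) {v : Ω → Vec p}
    (hv : AEMeasurable v P) (n k : ℕ) :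
    AEMeasurable (fun ω => sampleMoment (fun i => X i ω) n k (v ω)) P := by
  have hm : AEMeasurable (fun ω => sampleMean (fun i => X i ω) n) P :=
    (Finset.aemeasurable_fun_sum _ fun i _ => hX i).fun_const_smul _
  refine AEMeasurable.const_mul (Finset.aemeasurable_fun_sum _ fun i _ => ?_) _
  exact (hv.inner ((hX i).sub hm)).pow_const k

variable [IsProbabilityMeasure P]

lemma tendstoInDistribution_add_smul {Ω₁ Ω₂ : Type*} [MeasurableSpace Ω₁] [MeasurableSpace Ω₂]
    {P₁ : Measure Ω₁} [IsProbabilityMeasure P₁] {P₂ : Measure Ω₂} [IsProbabilityMeasure P₂]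
    {Y : ℕ → Ω → Vec p} {Z : Ω₁ → Vec p} {Z' : Ω₂ → Vec p} {c : ℕ → Ω → ℝ}
    (hX : TendstoInDistribution X atTop Z (fun _ => P) P₁)
    (hY : TendstoInDistribution Y atTop Z' (fun _ => P) P₂)
    (hc : ∀ n, AEMeasurable (c n) P) (hc0 : ∀ᵐ ω ∂P, Tendsto (fun n => c n ω) atTop (𝓝 0)) :
    TendstoInDistribution (fun n ω => X n ω + c n ω • Y n ω) atTop Z (fun _ => P) P₁ := by
  have h := hX.add_of_tendstoInMeasure_const (c := (0 : Vec p)) (tendstoInMeasure_smul hY hc hc0)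
    (fun n => (hc n).smul (hY.forall_aemeasurable n))
  exact TendstoInDistribution.congr (fun _ => ae_eq_refl _) (ae_of_all _ fun ω => add_zero (Z ω)) h

/-- Expansion of the score in terms of averages of the observations centered at `m`. -/
lemma score_eq {n : ℕ} (hn : n ≠ 0) (R : Vec p →L[ℝ] Vec p) (h m v : Vec p) (x : ℕ → Vec p) :
    score R h x n v =
      sampleMoment x n 2 v • avg n (fun i => inner ℝ (unitDir R h) (x i - m) ^ 2 •
        scoreOp R h (x i - m))
      - (2 * avg n (fun i => inner ℝ (unitDir R h) (x i - m)) * sampleMoment x n 2 v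
          + sampleMoment x n 3 v) •
        avg n (fun i => inner ℝ (unitDir R h) (x i - m) • scoreOp R h (x i - m))
      + (sampleMoment x n 2 v * (2 * avg n (fun i => inner ℝ (unitDir R h) (x i - m)) ^ 2
          - avg n (fun i => inner ℝ (unitDir R h) (x i - m) ^ 2))
          + sampleMoment x n 3 v * avg n (fun i => inner ℝ (unitDir R h) (x i - m))) •
        avg n (fun i => scoreOp R h (x i - m)) := by
  have hs : score R h x n v = scoreOp R h (sampleMoment x n 2 v •
      sampleThird x n (unitDir R h) (unitDir R h)
        - sampleMoment x n 3 v • sampleCov x n (unitDir R h)) := rfl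
  have hmap : ∀ f : ℕ → Vec p, scoreOp R h (avg n f) = avg n (fun i => scoreOp R h (f i)) :=
    fun f => map_avg (scoreOp R h).toLinearMap n f
  rw [hs, sampleThird_apply_eq hn x m, sampleCov_apply_eq hn x m]
  simp only [map_sub, map_add, map_smul, hmap, real_inner_comm _ (unitDir R h), ← pow_two]
  module

variable {α₁ : unitInterval} {μ₁ μ₂ : Vec p} {S : Matrix (Fin p) (Fin p) ℝ}

lemma PsiGamma_eq_smul : PsiGamma α₁ μ₁ μ₂ S = (Cgamma (mixBeta α₁) (mahalanobisSq μ₁ μ₂ S) *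
      ((1 + mixBeta α₁ * mahalanobisSq μ₁ μ₂ S) / (‖discriminant μ₁ μ₂ S‖ ^ 2 * mixBeta α₁))) •
    scoreCov (covOp S⁻¹ (μ₂ - μ₁)) S := by
  rw [PsiGamma, PsiU, smul_smul]; rfl

/-- The scalar factor is the integral of a square, hence nonnegative. -/
lemma posSemidef_PsiGamma (hS : S.PosDef) (hμ : μ₁ ≠ μ₂) (hα0 : (0 : ℝ) < α₁)
    (hα1 : (α₁ : ℝ) < 1) (hα : (α₁ : ℝ) ≠ 1 / 2) : (PsiGamma α₁ μ₁ μ₂ S).PosSemidef := by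
  rw [PsiGamma_eq_smul, ← integral_quad_xLaw hS hμ hα0 hα1 hα rfl rfl]
  exact (posSemidef_scoreCov hS _).smul (integral_nonneg fun x => sq_nonneg _)

lemma mixThird_ne_zero {a : ℝ} (h0 : 0 < a) (h1 : a < 1) (h : a ≠ 1 / 2) : mixThird a ≠ 0 :=
  mul_ne_zero (mul_pos h0 (by linarith)).ne' fun h2 => h (by linarith)

lemma avg_quad_smul (n : ℕ) (a : ℕ → ℝ) (z : ℕ → Vec p) (k₀ k₁ k₂ : ℝ) :
    avg n (fun i => (k₂ * a i ^ 2 + k₁ * a i + k₀) • z i) =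
      k₂ • avg n (fun i => a i ^ 2 • z i) + k₁ • avg n (fun i => a i • z i) + k₀ • avg n z := by
  simp only [avg, add_smul, mul_smul, Finset.sum_add_distrib, ← Finset.smul_sum, smul_add]
  simp only [smul_comm (n : ℝ)⁻¹]

/-- Slutsky: `v n` enters only through `B` and `C`, whose limits are known. Each deviation of a
coefficient from its limit multiplies a normalized sum that converges in distribution, so it is
negligible. -/
lemma tendstoInDistribution_score (hX : ∀ i, HasLaw (X i) (xLaw α₁ μ₁ μ₂ S) P)
    (hindep : iIndepFun X P) (hS : S.PosDef) (hμ : μ₁ ≠ μ₂) (hα0 : (0 : ℝ) < α₁)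
    (hα1 : (α₁ : ℝ) < 1) (hα : (α₁ : ℝ) ≠ 1 / 2) {v : ℕ → Ω → Vec p}
    (hv : ∀ n, AEMeasurable (v n) P)
    (hlim : ∀ᵐ ω ∂P, Tendsto (fun n => v n ω) atTop (𝓝 (unitDir (covOp S⁻¹) (μ₂ - μ₁)))) :
    TendstoInDistribution (fun (n : ℕ) ω => √(n : ℝ) •
      (popSkew (covOp S⁻¹) (μ₂ - μ₁) (mixThird α₁))⁻¹ •
        score (covOp S⁻¹) (μ₂ - μ₁) (fun i => X i ω) n (v n ω)) atTop id (fun _ => P)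
      (multivariateGaussian 0 (PsiGamma α₁ μ₁ μ₂ S)) := by
  have hh : μ₂ - μ₁ ≠ 0 := sub_ne_zero.2 hμ.symm
  have M := popModel hS hh
  have hXm := fun i => (hX i).aemeasurable
  have hmom := ae_momentsConverge hX hindep hS.posSemidef
  set m := mixMean α₁ μ₁ μ₂ with hm
  set R := covOp S⁻¹ with hR
  set h := μ₂ - μ₁ with hhdef
  set u := unitDir R h with hu
  set b := popVar R h (mixBeta α₁) with hb
  set c := popSkew R h (mixThird α₁) with hc
  have hc0 : c ≠ 0 := popSkew_ne_zero M (mixThird_ne_zero hα0 hα1 hα)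
  have hclt := tendstoInDistribution_quad hX hindep hS.posSemidef (u := u) (Γ := scoreOp R h)
    M.proj_theta (inner_adjoint_scoreOp hS hh) (posSemidef_scoreCov hS (R h))
    (inner_adjoint_scoreOp_self hS hh)
  have hW := hclt (-(c⁻¹ * b ^ 2)) (-1) (c⁻¹ * b)
  rw [integral_quad_xLaw hS hμ hα0 hα1 hα hb hc] at hW
  rw [← PsiGamma_eq_smul] at hW
  let A₁ : ℕ → Ω → ℝ := fun n ω => avg n (fun i => inner ℝ u (X i ω - m))
  let A₂ : ℕ → Ω → ℝ := fun n ω => avg n (fun i => inner ℝ u (X i ω - m) ^ 2)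
  let B : ℕ → Ω → ℝ := fun n ω => sampleMoment (fun i => X i ω) n 2 (v n ω)
  let C : ℕ → Ω → ℝ := fun n ω => sampleMoment (fun i => X i ω) n 3 (v n ω)
  have hinm : ∀ i, AEMeasurable (fun ω => inner ℝ u (X i ω - m)) P := fun i =>
    aemeasurable_const.inner ((hXm i).sub_const m)
  have hA₁m : ∀ n, AEMeasurable (A₁ n) P := fun n =>
    (Finset.aemeasurable_fun_sum _ fun i _ => hinm i).const_mul _
  have hA₂m : ∀ n, AEMeasurable (A₂ n) P := fun n =>
    (Finset.aemeasurable_fun_sum _ fun i _ => (hinm i).pow_const 2).const_mul _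
  have hBm : ∀ n, AEMeasurable (B n) P := fun n => aemeasurable_sampleMoment hXm (hv n) n 2
  have hCm : ∀ n, AEMeasurable (C n) P := fun n => aemeasurable_sampleMoment hXm (hv n) n 3
  have hconv : ∀ᵐ ω ∂P, Tendsto (fun n => A₁ n ω) atTop (𝓝 0) ∧
      Tendsto (fun n => A₂ n ω) atTop (𝓝 b) ∧ Tendsto (fun n => B n ω) atTop (𝓝 b) ∧
      Tendsto (fun n => C n ω) atTop (𝓝 c) := by
    filter_upwards [hmom, hlim] with ω h1 h2
    refine ⟨?_, ?_, tendsto_sampleMoment_two M h1 h2, tendsto_sampleMoment_three M h1 h2⟩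
    · have := h1.mean.inner (𝕜 := ℝ) (tendsto_const_nhds (x := u))
      simp only [inner_avg, inner_zero_left] at this
      simpa only [A₁, real_inner_comm u] using this
    · have := (tendsto_clm_apply h1.second (tendsto_const_nhds (x := u))).inner (𝕜 := ℝ)
        (tendsto_const_nhds (x := u))
      have e : inner ℝ (popSecond (covOp S) h (mixBeta α₁) u) u = b := by
        have := M.norm_pos
        simp only [popSecond_apply, inner_add_left, real_inner_smul_left, hu, M.map_unitDir,
          M.inner_unitDir, hb, popVar]
        field_simp
      rw [e] at this
      simp only [avg_clm_apply, outer_apply, inner_avg, real_inner_smul_left] at this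
      simpa only [A₂, real_inner_comm u, pow_two] using this
  -- The quadratic, linear and constant coefficients are corrected in turn, from their limits `c⁻¹
  -- b`, `-1`, `-(c⁻¹ b²)` to the exact values in `score_eq`.
  have h1 := tendstoInDistribution_add_smul hW (hclt 0 0 1)
    (c := fun n ω => c⁻¹ * (B n ω - b)) (fun n => ((hBm n).sub_const b).const_mul _)
    (by
      filter_upwards [hconv] with ω hω
      simpa using (hω.2.2.1.sub_const b).const_mul c⁻¹)
  have h2 := tendstoInDistribution_add_smul h1 (hclt 0 1 0)
    (c := fun n ω => 1 - c⁻¹ * (2 * A₁ n ω * B n ω + C n ω))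
    (fun n => ((((hA₁m n).const_mul 2).mul (hBm n)).add (hCm n)).const_mul c⁻¹ |>.const_sub 1)
    (by
      filter_upwards [hconv] with ω hω
      have := ((((hω.1.const_mul 2).mul hω.2.2.1).add hω.2.2.2).const_mul c⁻¹).const_sub 1
      simpa [hc0] using this)
  have h3 := tendstoInDistribution_add_smul h2 (hclt 1 0 0)
    (c := fun n ω => c⁻¹ * (B n ω * (2 * A₁ n ω ^ 2 - A₂ n ω) + C n ω * A₁ n ω + b ^ 2))
    (fun n => (((((hBm n).mul ((((hA₁m n).pow_const 2).const_mul 2).sub (hA₂m n))).add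
      ((hCm n).mul (hA₁m n))).add_const (b ^ 2)).const_mul c⁻¹))
    (by
      filter_upwards [hconv] with ω hω
      have := ((((hω.2.2.1.mul (((hω.1.pow 2).const_mul 2).sub hω.2.1)).add
        (hω.2.2.2.mul hω.1)).add_const (b ^ 2)).const_mul c⁻¹)
      convert! this using 2
      ring)
  refine h3.congr (fun n => ae_of_all _ fun ω => ?_) (ae_eq_refl _)
  rcases eq_or_ne n 0 with rfl | hn
  · simp
  simp only [← hm]
  rw [score_eq hn R h m]
  have hsq : ∀ f : ℕ → Vec p, (√(n : ℝ))⁻¹ • ∑ i ∈ Finset.range n, f i = √(n : ℝ) • avg n f := by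
    intro f
    have h0 : (0 : ℝ) < n := by positivity
    rw [avg, smul_smul]
    congr 1
    have := Real.mul_self_sqrt h0.le
    have h0' := Real.sqrt_pos.2 h0
    field_simp
    linarith
  simp only [hsq, avg_quad_smul, A₁, A₂, B, C, ← hu]
  module

end normality

end SkewnessPP

/-! ### Choice of signs and conclusion. -/

open SkewnessPP in
theorem mainTheorem3 {Ω : Type*} [MeasurableSpace Ω] (P : Measure Ω) [IsProbabilityMeasure P]
    {p : ℕ} (α₁ : unitInterval) (hα0 : (0 : ℝ) < α₁) (hα1 : (α₁ : ℝ) < 1)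
    (hα : (α₁ : ℝ) ≠ 1 / 2)
    (μ₁ μ₂ : EuclideanSpace ℝ (Fin p)) (hμ : μ₁ ≠ μ₂)
    (S : Matrix (Fin p) (Fin p) ℝ) (hS : S.PosDef)
    (X : ℕ → Ω → EuclideanSpace ℝ (Fin p))
    (hX : ∀ i, HasLaw (X i) (SkewnessPP.xLaw α₁ μ₁ μ₂ S) P) (hindep : iIndepFun X P)
    (u : ℕ → Ω → EuclideanSpace ℝ (Fin p)) (hu : ∀ n, AEMeasurable (u n) P)
    (humax : ∀ᵐ ω ∂P, ∀ᶠ n in atTop,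
      SkewnessPP.IsSkewnessMaximizer (fun i => X i ω) n (u n ω)) :
    (SkewnessPP.PsiGamma α₁ μ₁ μ₂ S).PosSemidef ∧
    ∃ s : ℕ → Ω → ℝ, (∀ n, Measurable (s n)) ∧ (∀ n ω, s n ω = -1 ∨ s n ω = 1) ∧
      (∀ᵐ ω ∂P, Tendsto (fun n => s n ω • u n ω) atTop
        (𝓝 (SkewnessPP.unitDiscriminant μ₁ μ₂ S))) ∧
      TendstoInDistribution
        (fun (n : ℕ) ω => √(n : ℝ) • (s n ω • u n ω - SkewnessPP.unitDiscriminant μ₁ μ₂ S))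
        atTop id (fun _ => P)
        (multivariateGaussian 0 (SkewnessPP.PsiGamma α₁ μ₁ μ₂ S)) := by
  have hh : μ₂ - μ₁ ≠ 0 := sub_ne_zero.2 hμ.symm
  have M := popModel hS hh
  have hβ : 0 ≤ mixBeta α₁ := (mul_pos hα0 (by linarith)).le
  have hc := mixThird_ne_zero hα0 hα1 hα
  have hmom := ae_momentsConverge hX hindep hS.posSemidef
  refine ⟨posSemidef_PsiGamma hS hμ hα0 hα1 hα, ?_⟩
  set w := unitDiscriminant μ₁ μ₂ S with hw
  have hw' : w = unitDir (covOp S⁻¹) (μ₂ - μ₁) := unitDiscriminant_eq μ₁ μ₂ S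
  -- The sign moves `u n` into the closed half space of `w`, which removes the antipodal ambiguity.
  -- The measurable modification of `u n` makes the sign genuinely measurable.
  let s : ℕ → Ω → ℝ := fun n ω => if 0 ≤ inner ℝ ((hu n).mk (u n) ω) w then 1 else -1
  have hs : ∀ n, Measurable (s n) := fun n =>
    Measurable.ite (measurableSet_le measurable_const
      ((hu n).measurable_mk.inner measurable_const)) measurable_const measurable_const
  have hs1 : ∀ n ω, s n ω = -1 ∨ s n ω = 1 := fun n ω => by
    simp only [s]
    split_ifs <;> simp
  have hae : ∀ᵐ ω ∂P, ∀ n, u n ω = (hu n).mk (u n) ω := ae_all_iff.2 fun n => (hu n).ae_eq_mk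
  have hvm : ∀ n, AEMeasurable (fun ω => s n ω • u n ω) P := fun n =>
    (hs n).aemeasurable.smul (hu n)
  have hmax : ∀ᵐ ω ∂P, ∀ᶠ n in atTop,
      IsSkewnessMaximizer (fun i => X i ω) n (s n ω • u n ω) := by
    filter_upwards [humax] with ω hω
    filter_upwards [hω] with n hn
    rcases hs1 n ω with h | h
    · rw [h, neg_one_smul]
      exact hn.neg
    · rwa [h, one_smul]
  have hpos : ∀ᵐ ω ∂P, ∀ n, 0 ≤ inner ℝ (s n ω • u n ω) w := by
    filter_upwards [hae] with ω hω n
    rw [real_inner_smul_left]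
    simp only [s, ← hω n]
    split_ifs with h
    · simpa using h
    · simpa using (not_le.1 h).le
  have hlim : ∀ᵐ ω ∂P, Tendsto (fun n => s n ω • u n ω) atTop (𝓝 w) := by
    filter_upwards [hmom, hmax, hpos] with ω h1 h2 h3
    rw [hw'] at h3 ⊢
    exact tendsto_of_maximizers M hβ hc h1 h2 (Eventually.of_forall h3)
  refine ⟨s, hs, hs1, hlim, ?_⟩
  rw [hw'] at hlim ⊢
  refine tendstoInDistribution_of_isEquivalent
    (tendstoInDistribution_score hX hindep hS hμ hα0 hα1 hα hvm hlim)
    (fun n => ((hvm n).sub_const _).fun_const_smul _) ?_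
  filter_upwards [hmom, hmax, hlim] with ω h1 h2 h3
  -- Asymptotic equivalence is preserved by the common factor `√n`.
  exact Asymptotics.IsEquivalent.refl.smul (isEquivalent_score M hβ hc h1 h2 h3)
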